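/- **Theorem (continuum of fixed points of period tripling renormalization).** *Setting.* For $0<c<\tfrac12$ let $u_c(x)=1-\big(\tfrac{x-c}{1-c}\big)^2$, and for $\varepsilon>0$ put $$s_1(c,\varepsilon)=\varepsilon\,u_c^3(0),\qquad s_2(c,\varepsilon)=u_c(\varepsilon\,u_c^3(0))-u_c(0),\qquad s_3(c)=1-u_c^2(0),\qquad \mathcal R(c,\varepsilon)=\frac{u_c(\varepsilon\,u_c^3(0))-c}{s_2(c,\varepsilon)} .$$ Let the feasible domain $F_d(\varepsilon)$ be the set of $c\in(0,\tfrac12)$ with $s_1,s_2,s_3>0$, $u_c(0)-s_1(c,\varepsilon)>0$ and $u_c^2(0)-u_c(s_1(c,\varepsilon))>0$. Let $T_3=\{s\in\mathbb R^3: s_i>0,\ \sum s_i<1\}$. A scaling data $s:\mathbb N\to T_3$ induces the maps $\tilde s_1(n)(t)=s_1(n)(1-t)$, $\tilde s_2(n)(t)=u_c(0)+s_2(n)(1-t)$, $\tilde s_3(n)(t)=1-s_3(n)(1-t)$ and, for $n\ge1$, the intervals $I_j^n=\tilde s_2(1)\circ\dots\circ\tilde s_2(n-1)\circ\tilde s_j(n)([0,1])$.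 It is *proper* if for some $\delta>0$ its values are at distance at least $\delta$ from $\partial T_3$ and $|I_j^n|\le(1-\delta)^n$ for all $n\ge 1$ and $j$. Let $I_2^0=[0,1]$ and let $y_n=\tilde s_2(1)\circ\dots\circ\tilde s_2(n)(1)$, an end point of $I_2^n$ (so $y_0=1$). The map $f_s:\bigcup_{n\ge1}(I_1^n\cup I_3^n)\to[0,1]$ is affine on each of these intervals. On $I_1^n$ it agrees with $u_c$ at both end points. On $I_3^{n}$ it agrees with $u_c$ at the end point $y_{n-1}$, and at the other end point it has the value $u_c(y_{n-1})+s_1(n)\,(1-u_c(y_{n-1}))$. A $C^{1+Lip}$ *unimodal map* is a $C^1$ map $f:[0,1]\to[0,1]$ with Lipschitz derivative and a unique critical point $c\in(0,1)$, strictly increasing on $[0,c]$ and strictly decreasing on $[c,1]$, normalised by $f(c)=1$, $f(1)=0$. It is *period tripling renormalizable* if $J=[f(0),f^4(0)]=[f^3(c),f^6(c)]$ is a proper subinterval of $[0,1]$ with $c$ in its interior, $J,f(J),f^2(J)$ have pairwise disjoint interiors, and $f^3(J)\subseteq J$. Then $Rf=h^{-1}\circ f^3\circ h$, where $h:[0,1]\to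 J$ is the orientation reversing affine homeomorphism. *Claim.* There is $\delta\in(0,1)$ such that for every $\varepsilon\in(1-\delta,1+\delta)$: 1. $\mathcal R(\cdot,\varepsilon)$ has exactly one fixed point $c^*_\varepsilon$ in $F_d(\varepsilon)$, and it is unstable: $\big|\tfrac{\partial\mathcal R}{\partial c}(c^*_\varepsilon,\varepsilon)\big|>1$; 2. with $c=c^*_\varepsilon$, the constant scaling data $s^*_\varepsilon(n)=(s_1(c^*_\varepsilon,\varepsilon),s_2(c^*_\varepsilon,\varepsilon),s_3(c^*_\varepsilon))$ is proper, and $\bigcap_{n\ge1}I_2^n=\{c^*_\varepsilon\}$; 3. $f_{s^*_\varepsilon}$ extends to a period tripling renormalizable $C^{1+Lip}$ unimodal map $\mathcal F_{s^*_\varepsilon}$ with critical point $c^*_\varepsilon$ and $R\mathcal F_{s^*_\varepsilon}=\mathcal F_{s^*_\varepsilon}$. Moreover $\varepsilon\mapsto c^*_\varepsilon$ is strictly decreasing on $(1-\delta,1+\delta)$, so the maps $\mathcal F_{s^*_\varepsilon}$ are pairwise distinct. In particular the set of fixed points of the period tripling renormalization operator acting on $C^{1+Lip}$ unimodal maps of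 $[0,1]$ has the cardinality of the continuum. -/

import Mathlib

open Set

namespace PeriodTripling

noncomputable section

/-- The quadratic unimodal family `u_c(x) = 1 - ((x - c) / (1 - c))²`. -/
def u (c x : ℝ) : ℝ := 1 - ((x - c) / (1 - c)) ^ 2

/-! ### Scaling data -/

/-- The open simplex `T_k` of scaling factors. -/
def T (k : ℕ) : Set (EuclideanSpace ℝ (Fin k)) :=
  {s | (∀ i, 0 < s i) ∧ ∑ i, s i < 1}

/-- The affine maps `s̃₁, s̃₂, s̃₃` induced by a scaling tri-factor `p`
(indices `0, 1, 2` stand for `1, 2, 3`). -/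
def branch (c : ℝ) (p : EuclideanSpace ℝ (Fin 3)) : Fin 3 → ℝ → ℝ
  | 0 => fun t => p 0 * (1 - t)
  | 1 => fun t => u c 0 + p 1 * (1 - t)
  | 2 => fun t => 1 - p 2 * (1 - t)

/-- `h_{s,n} = s̃₂(1) ∘ s̃₂(2) ∘ ⋯ ∘ s̃₂(n)`. A scaling data is indexed from `0` here, so that
`s n` is the tri-factor usually written `s(n+1)`. -/
def centralMap (c : ℝ) (s : ℕ → EuclideanSpace ℝ (Fin 3)) : ℕ → ℝ → ℝ
  | 0 => id
  | n + 1 => centralMap c s n ∘ branch c (s n) 1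

/-- The interval `I_{j+1}^{n+1}`, that is `s̃₂(1) ∘ ⋯ ∘ s̃₂(n) ∘ s̃_{j+1}(n+1)` applied to `[0,1]`. -/
def level (c : ℝ) (s : ℕ → EuclideanSpace ℝ (Fin 3)) (j : Fin 3) (n : ℕ) : Set ℝ :=
  (centralMap c s n ∘ branch c (s n) j) '' Icc 0 1

/-- Proper scaling data: values in `T₃`, at a distance at least `δ` from the boundary of `T₃`,
and `|I_j^n| ≤ (1 - δ)^n` for all `n ≥ 1` and all `j`. -/
def IsProper (c : ℝ) (s : ℕ → EuclideanSpace ℝ (Fin 3)) : Prop :=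
  ∃ δ : ℝ, 0 < δ ∧ (∀ n, s n ∈ T 3) ∧
    (∀ n, ∀ q ∈ frontier (T 3), δ ≤ dist (s n) q) ∧
    ∀ n j, Metric.diam (level c s j n) ≤ (1 - δ) ^ (n + 1)

/-- `f` extends the piece-wise affine map `f_s`, which is defined on the union of all the intervals
`I₁^n` and `I₃^n`, `n ≥ 1`. On `I₁^(n+1)` it is affine and agrees with `u_c` at both end points. On
`I₃^(n+1)` it is affine; at the end point `y_n = h_{s,n}(1)`, shared with `I₂^n`, it agrees
with `u_c`, and its image is the part `[u_c(y_n), u_c(y_n) + s₁(n+1) (1 - u_c(y_n))]` of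
`[u_c(y_n), 1]`. -/
def ExtendsPieces (c : ℝ) (s : ℕ → EuclideanSpace ℝ (Fin 3)) (f : ℝ → ℝ) : Prop :=
  ∀ n, ∀ t ∈ Icc (0 : ℝ) 1,
    f (centralMap c s n (branch c (s n) 0 t)) =
        (1 - t) * u c (centralMap c s n (branch c (s n) 0 0)) +
          t * u c (centralMap c s n (branch c (s n) 0 1)) ∧
    f (centralMap c s n (branch c (s n) 2 t)) =
        (1 - t) * (u c (centralMap c s n 1) + s n 0 * (1 - u c (centralMap c s n 1))) +
          t * u c (centralMap c s n 1)

/-! ### The `ε`-variation -/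

/-- `s₁(c,ε) = ε u_c³(0)`. -/
def s₁ (c ε : ℝ) : ℝ := ε * (u c)^[3] 0

/-- `s₂(c,ε) = u_c(ε u_c³(0)) - u_c(0)`. -/
def s₂ (c ε : ℝ) : ℝ := u c (ε * (u c)^[3] 0) - u c 0

/-- `s₃(c,ε) = 1 - u_c²(0)`; it does not depend on `ε`. -/
def s₃ (c : ℝ) : ℝ := 1 - (u c)^[2] 0

/-- The constant scaling data `n ↦ (s₁(c,ε), s₂(c,ε), s₃(c,ε))`. -/
def scaling (c ε : ℝ) : ℕ → EuclideanSpace ℝ (Fin 3) :=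
  fun _ => !₂[s₁ c ε, s₂ c ε, s₃ c]

/-- The perturbed map `𝓡(c,ε) = (u_c(ε u_c³(0)) - c) / s₂(c,ε)`. -/
def R (c ε : ℝ) : ℝ := (u c (ε * (u c)^[3] 0) - c) / s₂ c ε

/-- The feasible domain: `0 < c < 1/2`, the three scaling factors are positive, and so are the two
gaps between the intervals `[0, s₁]`, `[u_c(0), u_c(0) + s₂]`, `[1 - s₃, 1]`. -/
def feasible (ε : ℝ) : Set ℝ :=
  {c | 0 < c ∧ c < 1 / 2 ∧ 0 < s₁ c ε ∧ 0 < s₂ c ε ∧ 0 < s₃ c ∧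
    0 < u c 0 - s₁ c ε ∧ 0 < (u c)^[2] 0 - u c (s₁ c ε)}

/-! ### Unimodal maps and period tripling renormalization

Maps of `[0,1]` are represented by functions `ℝ → ℝ` of which only the values on `[0,1]` matter. -/

/-- `f` is a `C^{1+Lip}` unimodal map of `[0,1]` with unique critical point `c`, normalised (as
every `u_c` is) by `f c = 1` and `f 1 = 0`. -/
structure IsC1LipUnimodal (f : ℝ → ℝ) (c : ℝ) : Prop where
  mem : c ∈ Ioo (0 : ℝ) 1
  mapsTo : MapsTo f (Icc 0 1) (Icc 0 1)
  contDiff : ContDiffOn ℝ 1 f (Icc 0 1)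
  lipschitz : ∃ K : NNReal, LipschitzOnWith K (derivWithin f (Icc 0 1)) (Icc 0 1)
  critical : ∀ x ∈ Icc (0 : ℝ) 1, derivWithin f (Icc 0 1) x = 0 ↔ x = c
  mono : StrictMonoOn f (Icc 0 c)
  anti : StrictAntiOn f (Icc c 1)
  map_crit : f c = 1
  map_one : f 1 = 0

/-- The central interval `J = [f 0, f⁴ 0]`. As `f² c = 0`, its end points are `f³ c` and `f⁶ c`. -/
def central (f : ℝ → ℝ) : Set ℝ := Icc (f 0) (f^[4] 0)

/-- `f`, with critical point `c`, is period tripling renormalizable: `J` is a proper subinterval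
of `[0,1]` with `c` in its interior, the sets `J, f J, f² J` have pairwise disjoint interiors, and
`f³ J ⊆ J`. -/
structure IsRenormalizable (f : ℝ → ℝ) (c : ℝ) : Prop where
  crit_mem : c ∈ Ioo (f 0) (f^[4] 0)
  ssubset : central f ⊂ Icc 0 1
  disjoint : ∀ i < 3, ∀ j < 3, i ≠ j →
    Disjoint (interior (f^[i] '' central f)) (interior (f^[j] '' central f))
  mapsTo : MapsTo f^[3] (central f) (central f)

/-- The orientation reversing affine homeomorphism `h` from `[0,1]` onto `J`. -/
def h (f : ℝ → ℝ) (t : ℝ) : ℝ := f 0 + (f^[4] 0 - f 0) * (1 - t)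

/-- The inverse of `h`. -/
def hInv (f : ℝ → ℝ) (x : ℝ) : ℝ := (f^[4] 0 - x) / (f^[4] 0 - f 0)

/-- The period tripling renormalization operator `f ↦ h⁻¹ ∘ f³ ∘ h`. -/
def renorm (f : ℝ → ℝ) : ℝ → ℝ := hInv f ∘ f^[3] ∘ h f

/-- `f` is a `C^{1+Lip}` unimodal map with critical point `c`, and a fixed point of period tripling
renormalization. -/
def IsFixedPoint (f : ℝ → ℝ) (c : ℝ) : Prop :=
  IsC1LipUnimodal f c ∧ IsRenormalizable f c ∧ EqOn (renorm f) f (Icc 0 1)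

/-- The set of all `C^{1+Lip}` unimodal fixed points, as functions on `[0,1]`. -/
def fixedPoints : Set (Icc (0 : ℝ) 1 → ℝ) :=
  {g | ∃ f c, IsFixedPoint f c ∧ (Icc (0 : ℝ) 1).domRestrict f = g}

end

end PeriodTripling

open PeriodTripling

namespace PeriodTripling

noncomputable section

/-! Put `σ = s₂`, `v = u c 0`, `a = s₁`. A feasible fixed point of `R · ε` means exactly that `x ↦ v
+ σ (1 - x)` fixes `c`. As `u c` is quadratic about `c`, it is equivariant under this map
(`u_sub_mul`), which forces `s₃ = σ ^ 2`. A `C¹` extension of the affine pieces with the same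
equivariance is a renormalization fixed point: on the central interval `F` is a rescaled copy of
itself, and the next two iterates follow affine pieces, so `F³ ∘ h = h ∘ F`.

Such an `F` is obtained from its slope. The slope is prescribed on `[0, a]` and `[1 - σ ^ 2, 1]`,
interpolated over the two gaps (`exists_lipschitz_slope`), then copied into the centre by `φ (c - σ
(x - c)) = -σ φ x` (`exists_selfSimilar_slope`). Values and lengths shrink by the same factor, so
one Lipschitz constant serves all scales; integration gives `F` (`exists_isSelfSimilar`).

It remains to solve `R c ε = c`. In `q = c / (1 - c)` the equation is `ε * η q = 1`. Since `η`
increases on the relevant range, the solution exists, is unique and decreases with `ε`. Different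
`ε` then give different critical points, hence different maps; continuity bounds the number of fixed
points by the continuum. -/

/-! ### Monotone interpolation across a gap -/

/-- Two positive slopes and a positive increment are interpolated by a positive Lipschitz slope,
constant outside the interval (the derivative of a rational quadratic spline). -/
theorem exists_lipschitz_slope {a b p q M : ℝ} (hab : a < b) (hp : 0 < p) (hq : 0 < q)
    (hM : 0 < M) :
    ∃ (K : NNReal) (ψ : ℝ → ℝ), LipschitzWith K ψ ∧ (∀ x, 0 < ψ x) ∧ (∀ x ≤ a, ψ x = p) ∧
      (∀ x, b ≤ x → ψ x = q) ∧ ∫ x in a..b, ψ x = M := by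
  obtain ⟨w, hw⟩ : ∃ w, w = b - a := ⟨_, rfl⟩
  have hw0 : 0 < w := hw ▸ sub_pos.2 hab
  obtain ⟨m, hm⟩ : ∃ m, m = M / w := ⟨_, rfl⟩
  have hm0 : 0 < m := hm ▸ div_pos hM hw0
  have hMw : M = m * w := by rw [hm]; field_simp
  have hb : (b - a) / w = 1 := by rw [hw]; exact div_self (sub_pos.2 hab).ne'
  -- With `θ = (x - a) / w` and mean slope `m`, `P` is the rational quadratic that rises by `M` over
  -- `[a, b]` with end slopes `p` and `q`; `d` is its derivative, a quotient visibly positive for `θ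
  -- ∈ [0, 1]`.
  let den : ℝ → ℝ := fun x => m + (p + q - 2 * m) * ((x - a) / w) * (1 - (x - a) / w)
  let num : ℝ → ℝ := fun x =>
    q * ((x - a) / w) ^ 2 + 2 * m * ((x - a) / w) * (1 - (x - a) / w) +
      p * (1 - (x - a) / w) ^ 2
  let P : ℝ → ℝ := fun x =>
    M * (m * ((x - a) / w) ^ 2 + p * ((x - a) / w) * (1 - (x - a) / w)) / den x
  let d : ℝ → ℝ := fun x => m ^ 2 * num x / den x ^ 2
  have hθ : ∀ x ∈ Icc a b, 0 ≤ (x - a) / w ∧ 0 ≤ 1 - (x - a) / w := by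
    intro x hx
    refine ⟨div_nonneg (by linarith [hx.1]) hw0.le, ?_⟩
    rw [sub_nonneg, div_le_one hw0]
    linarith [hx.2]
  have hden : ∀ x ∈ Icc a b, 0 < den x := by
    intro x hx
    obtain ⟨h1, h2⟩ := hθ x hx
    have h3 := mul_nonneg h1 h2
    have : den x = m * (((x - a) / w) ^ 2 + (1 - (x - a) / w) ^ 2) +
        (p + q) * ((x - a) / w * (1 - (x - a) / w)) := by simp only [den]; ring
    rw [this]
    have h4 : 0 < ((x - a) / w) ^ 2 + (1 - (x - a) / w) ^ 2 := by
      nlinarith [sq_nonneg ((x - a) / w - (1 - (x - a) / w))]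
    have := mul_pos hm0 h4
    have := mul_nonneg (add_pos hp hq).le h3
    linarith
  have hd : ∀ x ∈ Icc a b, 0 < d x := by
    intro x hx
    obtain ⟨h1, h2⟩ := hθ x hx
    have h5 : 0 < num x := by
      rcases h1.eq_or_lt with h | h
      · have : num x = p := by simp only [num, ← h]; ring
        rw [this]; exact hp
      · have := mul_nonneg (mul_nonneg hm0.le h.le) h2
        have := mul_nonneg hp.le (sq_nonneg (1 - (x - a) / w))
        have := mul_pos hq (pow_pos h 2)
        simp only [num]
        nlinarith
    exact div_pos (mul_pos (pow_pos hm0 2) h5) (pow_pos (hden x hx) 2)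
  have hP : ∀ x ∈ Icc a b, HasDerivAt P (d x) x := by
    intro x hx
    have hD := (hden x hx).ne'
    have e : HasDerivAt (fun x : ℝ => (x - a) / w) (1 / w) x :=
      ((hasDerivAt_id x).sub_const a).div_const w
    have e1 : HasDerivAt (fun x : ℝ => 1 - (x - a) / w) (-(1 / w)) x := by
      simpa using e.const_sub 1
    have e2 : HasDerivAt den _ x := ((e.const_mul (p + q - 2 * m)).mul e1).const_add m
    have e3 : HasDerivAt (fun x : ℝ => M * (m * ((x - a) / w) ^ 2 +
        p * ((x - a) / w) * (1 - (x - a) / w))) _ x :=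
      (((e.pow 2).const_mul m).add ((e.const_mul p).mul e1)).const_mul M
    have e4 : HasDerivAt P _ x := e3.div e2 hD
    convert e4 using 1
    simp only [d]
    congr 1
    rw [hMw]
    simp only [num, den, Nat.cast_ofNat]
    generalize (x - a) / w = θ
    field_simp
    ring
  have hcd : ContDiffOn ℝ 1 d (Icc a b) := by
    refine ContDiffOn.div ?_ ?_ fun x hx => (pow_pos (hden x hx) 2).ne'
    · simp only [num]; fun_prop
    · simp only [den]; fun_prop
  obtain ⟨K, hK⟩ := hcd.exists_lipschitzOnWith (by norm_num) (convex_Icc a b) isCompact_Icc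
  -- Composing `d` with the projection onto `[a, b]` makes it globally Lipschitz and constant
  -- outside.
  have hr : ∀ x, max a (min b x) ∈ Icc a b := fun x =>
    ⟨le_max_left _ _, max_le hab.le (min_le_left _ _)⟩
  refine ⟨K, fun x => d (max a (min b x)), ?_, fun x => hd _ (hr x), ?_, ?_, ?_⟩
  · have hcl : LipschitzWith 1 fun x : ℝ => max a (min b x) :=
      (LipschitzWith.id.const_min b).const_max a
    have := hK.comp (hcl.lipschitzOnWith (s := univ)) fun x _ => hr x
    rw [mul_one] at this
    exact lipschitzOnWith_univ.1 this
  · intro x hx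
    have : max a (min b x) = a := max_eq_left ((min_le_right _ _).trans hx)
    simp only [this, d, num, den]
    field_simp
    ring
  · intro x hx
    have : max a (min b x) = b := by rw [min_eq_left hx, max_eq_right hab.le]
    simp only [this, d, num, den, hb, sub_self, mul_zero, add_zero, mul_one, one_pow]
    field_simp
    ring
  · have e : EqOn (fun x => d (max a (min b x))) d (uIcc a b) := by
      intro x hx
      rw [uIcc_of_le hab.le] at hx
      simp only [min_eq_right hx.2, max_eq_right hx.1]
    rw [intervalIntegral.integral_congr e,
      intervalIntegral.integral_eq_sub_of_hasDerivAt (f := P)]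
    · simp only [P, den, hb, sub_self, mul_zero, add_zero, mul_one, one_pow, zero_div, sub_zero,
        zero_pow two_ne_zero]
      field_simp
    · intro x hx
      rw [uIcc_of_le hab.le] at hx
      exact hP x hx
    · exact (hcd.continuousOn.mono (by rw [uIcc_of_le hab.le])).intervalIntegrable

/-! ### Self-similar slopes -/

section SelfSimilar

variable {c σ : ℝ} {l r : ℝ → ℝ}

/-- A bounded solution `φ` of `φ (c - σ (x - c)) = -σ φ x` with prescribed values outside the
central interval. -/
theorem exists_selfSimilar (hσ0 : 0 < σ) (hσ1 : σ < 1) {ψ : ℝ → ℝ} {B : ℝ}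
    (hB : ∀ x, |ψ x| ≤ B) {I : Set ℝ} (hI : ∀ x ∈ I, ψ x = 0) :
    ∃ φ : ℝ → ℝ, (∃ B', ∀ x, |φ x| ≤ B') ∧ (∀ x ∉ I, φ x = ψ x) ∧
      ∀ x, c - σ * (x - c) ∈ I → φ (c - σ * (x - c)) = -σ * φ x := by
  classical
  -- `G n` is `ψ` transported `n` times by `x ↦ c - σ (x - c)`, with a factor `-σ` and a cut-off to
  -- `I` each time. The solution is the geometrically convergent sum of the `G n`.
  let G : ℕ → ℝ → ℝ := fun n => Nat.rec ψ
    (fun _ g x => if x ∈ I then -σ * g (c - (x - c) / σ) else 0) n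
  have G1 : ∀ n x, G (n + 1) x = if x ∈ I then -σ * G n (c - (x - c) / σ) else 0 :=
    fun _ _ => rfl
  have hB0 : 0 ≤ B := (abs_nonneg _).trans (hB 0)
  have hG : ∀ n x, |G n x| ≤ B * σ ^ n := by
    intro n
    induction n with
    | zero => intro x; rw [pow_zero, mul_one]; exact hB x
    | succ n ih =>
      intro x
      rw [G1]
      split_ifs
      · rw [abs_mul, abs_neg, abs_of_pos hσ0, pow_succ]
        have := mul_le_mul_of_nonneg_left (ih (c - (x - c) / σ)) hσ0.le
        linarith
      · rw [abs_zero]; positivity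
  have hgeo : Summable fun n => B * σ ^ n :=
    (summable_geometric_of_lt_one hσ0.le hσ1).mul_left B
  have hsum : ∀ x, Summable fun n => G n x := fun x =>
    Summable.of_norm_bounded (f := fun n => G n x) hgeo fun n => hG n x
  have hsplit : ∀ x, ∑' n, G n x = ψ x + ∑' n, G (n + 1) x := fun x => (hsum x).tsum_eq_zero_add
  refine ⟨fun x => ∑' n, G n x, ⟨∑' n, B * σ ^ n, fun x => ?_⟩, fun x hx => ?_, fun x hx => ?_⟩
  · exact tsum_of_norm_bounded (f := fun n => G n x) hgeo.hasSum fun n => hG n x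
  · simp only [hsplit, G1, if_neg hx, tsum_zero, add_zero]
  · have e : c - (c - σ * (x - c) - c) / σ = x := by field_simp; ring
    simp only
    rw [hsplit, hI _ hx, zero_add, ← tsum_mul_left]
    simp only [G1, if_pos hx, e]

/-- Lipschitz slopes `l > 0` and `r < 0`, given to the left and to the right of the central interval
with compatible end values, extend to a Lipschitz self-similar slope. -/
theorem exists_selfSimilar_slope {K : NNReal} (hc0 : 0 < c) (hc1 : c < 1) (hσ0 : 0 < σ)
    (hσ1 : σ < 1) (hl : LipschitzWith K l) (hr : LipschitzWith K r) (hl0 : ∀ x, 0 < l x)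
    (hr0 : ∀ x, r x < 0) (hlr : l (c - σ * (1 - c)) = -σ * r 1)
    (hrl : r (c - σ * (0 - c)) = -σ * l 0)
    (hpos : 0 < c - σ * (1 - c)) (hlt : c - σ * (0 - c) < 1) :
    ∃ φ : ℝ → ℝ, LipschitzWith K φ ∧ (∀ x ∈ Icc 0 (c - σ * (1 - c)), φ x = l x) ∧
      (∀ x ∈ Icc (c - σ * (0 - c)) 1, φ x = r x) ∧
      (∀ x ∈ Icc (0 : ℝ) 1, φ (c - σ * (x - c)) = -σ * φ x) ∧
      ∀ x ∈ Icc (0 : ℝ) 1, x ≠ c → 0 < φ x * (c - x) := by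
  classical
  set a := c - σ * (1 - c) with ha
  set b := c - σ * (0 - c) with hb
  have hac : a < c := by have := mul_pos hσ0 (sub_pos.2 hc1); linarith
  have hcb : c < b := by have := mul_pos hσ0 hc0; linarith
  let ψ : ℝ → ℝ := fun x => if x ∈ Ico 0 a then l x else if x ∈ Ioc b 1 then r x else 0
  obtain ⟨Bl, hBl⟩ := (isCompact_Icc (a := (0 : ℝ)) (b := 1)).exists_bound_of_continuousOn
    hl.continuous.continuousOn
  obtain ⟨Br, hBr⟩ := (isCompact_Icc (a := (0 : ℝ)) (b := 1)).exists_bound_of_continuousOn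
    hr.continuous.continuousOn
  have hBl0 : 0 ≤ Bl := (norm_nonneg _).trans (hBl 0 (by simp))
  have hBr0 : 0 ≤ Br := (norm_nonneg _).trans (hBr 0 (by simp))
  have hψB : ∀ x, |ψ x| ≤ Bl + Br := by
    intro x
    simp only [ψ]
    split_ifs with h1 h2
    · have := hBl x ⟨h1.1, by linarith [h1.2]⟩
      rw [Real.norm_eq_abs] at this; linarith
    · have := hBr x ⟨by linarith [h2.1], h2.2⟩
      rw [Real.norm_eq_abs] at this; linarith
    · rw [abs_zero]; linarith
  have hψI : ∀ x ∈ Icc a b, ψ x = 0 := by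
    intro x hx
    simp only [ψ]
    rw [if_neg (fun h => by linarith [h.2, hx.1]), if_neg (fun h => by linarith [h.1, hx.2])]
  obtain ⟨f, ⟨B, hB⟩, hf1, hf2⟩ := exists_selfSimilar (c := c) hσ0 hσ1 hψB hψI
  have hmem : ∀ x ∈ Icc (0 : ℝ) 1, c - σ * (x - c) ∈ Icc a b := by
    intro x hx
    constructor
    · rw [ha]; nlinarith [hx.2]
    · rw [hb]; nlinarith [hx.1]
  have hfs : ∀ x ∈ Icc (0 : ℝ) 1, f (c - σ * (x - c)) = -σ * f x := fun x hx => hf2 x (hmem x hx)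
  have hfl' : ∀ x ∈ Ico 0 a, f x = l x := by
    intro x hx
    rw [hf1 x (fun h => by linarith [h.1, hx.2])]
    simp only [ψ, if_pos hx]
  have hfr' : ∀ x ∈ Ioc b 1, f x = r x := by
    intro x hx
    rw [hf1 x (fun h => by linarith [h.2, hx.1])]
    simp only [ψ]
    rw [if_neg (fun h => by linarith [h.2, hx.1]), if_pos hx]
  have hfl : ∀ x ∈ Icc 0 a, f x = l x := by
    intro x hx
    rcases hx.2.eq_or_lt with h | h
    · rw [h, ha, hfs 1 (by simp), hfr' 1 ⟨hlt, le_rfl⟩, ← hlr]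
    · exact hfl' x ⟨hx.1, h⟩
  have hfr : ∀ x ∈ Icc b 1, f x = r x := by
    intro x hx
    rcases hx.1.eq_or_lt with h | h
    · rw [← h, hb, hfs 0 (by simp), hfl' 0 ⟨le_rfl, hpos⟩, ← hrl]
    · exact hfr' x ⟨h, hx.2⟩
  -- the functional equation improves the error in an approximate Lipschitz bound
  have hinv : ∀ x ∈ Icc a b, ∃ z ∈ Icc (0 : ℝ) 1, x = c - σ * (z - c) := by
    intro x hx
    refine ⟨c - (x - c) / σ, ⟨?_, ?_⟩, by field_simp; ring⟩
    · rw [sub_nonneg, div_le_iff₀ hσ0]; linarith [hx.2]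
    · rw [sub_le_comm, le_div_iff₀ hσ0]; linarith [hx.1]
  have step : ∀ e, 0 ≤ e →
      (∀ x ∈ Icc (0 : ℝ) 1, ∀ y ∈ Icc (0 : ℝ) 1, |f x - f y| ≤ K * |x - y| + e) →
      ∀ x ∈ Icc (0 : ℝ) 1, ∀ y ∈ Icc (0 : ℝ) 1, x ≤ y → |f x - f y| ≤ K * (y - x) + σ * e := by
    intro e he H
    have he' : 0 ≤ σ * e := mul_nonneg hσ0.le he
    -- Values and distances are both scaled by `σ` here, so `K` is reproduced exactly and only the
    -- error `e` shrinks.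
    have hC : ∀ x ∈ Icc a b, ∀ y ∈ Icc a b, x ≤ y → |f x - f y| ≤ K * (y - x) + σ * e := by
      intro x hx y hy hxy
      obtain ⟨z, hz, rfl⟩ := hinv x hx
      obtain ⟨v, hv, rfl⟩ := hinv y hy
      rw [hfs z hz, hfs v hv, ← mul_sub, abs_mul, abs_neg, abs_of_pos hσ0]
      have hvz : v ≤ z := by nlinarith
      have := mul_le_mul_of_nonneg_left (H z hz v hv) hσ0.le
      rw [abs_of_nonneg (sub_nonneg.2 hvz)] at this
      linarith
    have hL : ∀ x ∈ Icc 0 a, ∀ y ∈ Icc 0 a, x ≤ y → |f x - f y| ≤ K * (y - x) := by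
      intro x hx y hy hxy
      rw [hfl x hx, hfl y hy]
      have := hl.dist_le_mul x y
      rwa [Real.dist_eq, Real.dist_eq, abs_sub_comm x y, abs_of_nonneg (sub_nonneg.2 hxy)] at this
    have hR : ∀ x ∈ Icc b 1, ∀ y ∈ Icc b 1, x ≤ y → |f x - f y| ≤ K * (y - x) := by
      intro x hx y hy hxy
      rw [hfr x hx, hfr y hy]
      have := hr.dist_le_mul x y
      rwa [Real.dist_eq, Real.dist_eq, abs_sub_comm x y, abs_of_nonneg (sub_nonneg.2 hxy)] at this
    have hab : a ≤ b := by linarith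
    have hLC : ∀ x ∈ Icc 0 a, ∀ y ∈ Icc a b, |f x - f y| ≤ K * (y - x) + σ * e := by
      intro x hx y hy
      have h1 := hL x hx a ⟨hpos.le, le_rfl⟩ hx.2
      have h2 := hC a ⟨le_rfl, hab⟩ y hy hy.1
      have h3 := abs_sub_le (f x) (f a) (f y)
      linarith
    -- Splitting at `a` and `b` leaves at most one segment in the centre; the outer ones carry no
    -- error, so `σ * e` enters only once.
    intro x hx y hy hxy
    rcases le_total x a with hxa | hxa
    · rcases le_total y a with hya | hya
      · linarith [hL x ⟨hx.1, hxa⟩ y ⟨hy.1, hya⟩ hxy]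
      rcases le_total y b with hyb | hyb
      · exact hLC x ⟨hx.1, hxa⟩ y ⟨hya, hyb⟩
      · have h1 := hLC x ⟨hx.1, hxa⟩ b ⟨hab, le_rfl⟩
        have h2 := hR b ⟨le_rfl, hlt.le⟩ y ⟨hyb, hy.2⟩ hyb
        have h3 := abs_sub_le (f x) (f b) (f y)
        linarith
    · rcases le_total x b with hxb | hxb
      · rcases le_total y b with hyb | hyb
        · exact hC x ⟨hxa, hxb⟩ y ⟨hxa.trans hxy, hyb⟩ hxy
        · have h1 := hC x ⟨hxa, hxb⟩ b ⟨hab, le_rfl⟩ hxb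
          have h2 := hR b ⟨le_rfl, hlt.le⟩ y ⟨hyb, hy.2⟩ hyb
          have h3 := abs_sub_le (f x) (f b) (f y)
          linarith
      · linarith [hR x ⟨hxb, hx.2⟩ y ⟨hxb.trans hxy, hy.2⟩ hxy]
  have step' : ∀ e, 0 ≤ e →
      (∀ x ∈ Icc (0 : ℝ) 1, ∀ y ∈ Icc (0 : ℝ) 1, |f x - f y| ≤ K * |x - y| + e) →
      ∀ x ∈ Icc (0 : ℝ) 1, ∀ y ∈ Icc (0 : ℝ) 1, |f x - f y| ≤ K * |x - y| + σ * e := by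
    intro e he H x hx y hy
    rcases le_total x y with hxy | hxy
    · rw [abs_sub_comm x y, abs_of_nonneg (sub_nonneg.2 hxy)]
      exact step e he H x hx y hy hxy
    · rw [abs_sub_comm (f x), abs_of_nonneg (sub_nonneg.2 hxy)]
      exact step e he H y hy x hx hxy
  have hB0 : 0 ≤ B := (abs_nonneg _).trans (hB 0)
  have hN : ∀ N : ℕ, ∀ x ∈ Icc (0 : ℝ) 1, ∀ y ∈ Icc (0 : ℝ) 1,
      |f x - f y| ≤ K * |x - y| + σ ^ N * (2 * B) := by
    intro N
    induction N with
    | zero =>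
      intro x _ y _
      have h1 := abs_sub (f x) (f y)
      have h2 : 0 ≤ K * |x - y| := by positivity
      linarith [hB x, hB y]
    | succ N ih =>
      intro x hx y hy
      have := step' _ (by positivity) ih x hx y hy
      rw [pow_succ']
      linarith
  have hLip : LipschitzOnWith K f (Icc 0 1) := by
    refine LipschitzOnWith.of_dist_le_mul fun x hx y hy => ?_
    rw [Real.dist_eq, Real.dist_eq]
    have ht : Filter.Tendsto (fun N : ℕ => K * |x - y| + σ ^ N * (2 * B)) Filter.atTop
        (nhds (K * |x - y| + 0 * (2 * B))) :=
      ((tendsto_pow_atTop_nhds_zero_of_lt_one hσ0.le hσ1).mul_const _).const_add _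
    rw [zero_mul, add_zero] at ht
    exact ge_of_tendsto' ht fun N => hN N x hx y hy
  -- A point other than `c` leaves the centre after finitely many rescalings, and each multiplies `f
  -- x * (c - x)` by a positive power of `σ`.
  have hsign : ∀ N : ℕ, ∀ x ∈ Icc (0 : ℝ) 1, σ ^ N < |x - c| → 0 < f x * (c - x) := by
    intro N
    induction N with
    | zero =>
      intro x hx h
      rw [pow_zero] at h
      have : |x - c| ≤ 1 := abs_le.2 ⟨by linarith [hx.1], by linarith [hx.2]⟩
      linarith
    | succ N ih =>
      intro x hx h
      by_cases hxa : x < a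
      · rw [hfl x ⟨hx.1, hxa.le⟩]
        exact mul_pos (hl0 x) (by linarith)
      by_cases hxb : b < x
      · rw [hfr x ⟨hxb.le, hx.2⟩]
        exact mul_pos_of_neg_of_neg (hr0 x) (by linarith)
      obtain ⟨z, hz, rfl⟩ := hinv x ⟨not_lt.1 hxa, not_lt.1 hxb⟩
      have e : |c - σ * (z - c) - c| = σ * |z - c| := by
        rw [show c - σ * (z - c) - c = -(σ * (z - c)) by ring, abs_neg, abs_mul, abs_of_pos hσ0]
      rw [e, pow_succ', mul_lt_mul_iff_right₀ hσ0] at h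
      have := mul_pos (pow_pos hσ0 2) (ih z hz h)
      rw [hfs z hz]
      linarith
  obtain ⟨φ, hφ, hφf⟩ := hLip.extend_real
  have ha1 : ∀ x ∈ Icc 0 a, x ∈ Icc (0 : ℝ) 1 := fun x hx => ⟨hx.1, by linarith [hx.2]⟩
  have hb1 : ∀ x ∈ Icc b 1, x ∈ Icc (0 : ℝ) 1 := fun x hx => ⟨by linarith [hx.1], hx.2⟩
  refine ⟨φ, hφ, fun x hx => ?_, fun x hx => ?_, fun x hx => ?_, fun x hx hxc => ?_⟩
  · rw [← hφf (ha1 x hx), hfl x hx]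
  · rw [← hφf (hb1 x hx), hfr x hx]
  · have := hmem x hx
    rw [← hφf hx, ← hφf ⟨by linarith [this.1], by linarith [this.2]⟩, hfs x hx]
  · rw [← hφf hx]
    obtain ⟨N, hN⟩ := exists_pow_lt_of_lt_one (abs_pos.2 (sub_ne_zero.2 hxc)) hσ1
    exact hsign N x hx hN

end SelfSimilar

/-! ### Self-similar unimodal maps -/

/-- `F`, with derivative `g`, is unimodal with critical point `c`, is affine on `[0, a]` and on
`[1 - σ², 1]`, and is self-similar under `x ↦ v + σ (1 - x)`. -/
structure IsSelfSimilar (c v a σ : ℝ) (F g : ℝ → ℝ) : Prop where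
  lipschitz : ∃ K : NNReal, LipschitzWith K g
  hasDerivAt : ∀ x, HasDerivAt F (g x) x
  sign : ∀ x ∈ Icc (0 : ℝ) 1, x ≠ c → 0 < g x * (c - x)
  deriv_crit : g c = 0
  map_crit : F c = 1
  map_one : F 1 = 0
  selfSimilar : ∀ x ∈ Icc (0 : ℝ) 1, F (v + σ * (1 - x)) = 1 - σ ^ 2 * (1 - F x)
  left : ∀ x ∈ Icc 0 a, F x = v + σ * x / a
  right : ∀ x ∈ Icc (1 - σ ^ 2) 1, F x = a * (1 - x) / σ ^ 2

/-- `F` is `1` plus the integral from `c` of a self-similar slope. The slopes at the inner ends of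
the gaps are dictated by the functional equation: `-σ * (-a / σ²) = a / σ` at `v` and `-σ * (σ / a)
= -σ² / a` at `v + σ`. The increments over the gaps are those compatible with `F 0 = v` and `F 1 =
0`. -/
theorem exists_isSelfSimilar {c v a σ : ℝ} (hc0 : 0 < c) (hc1 : c < 1) (ha : 0 < a) (hav : a < v)
    (hσ : 0 < σ) (hfix : v + σ * (1 - c) = c) (hgap : v + σ < 1 - σ ^ 2) :
    ∃ F g, IsSelfSimilar c v a σ F g := by
  have hσ1 : σ < 1 := by nlinarith
  have hσ2 : 0 < σ ^ 2 := by positivity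
  have hσ3 : σ ^ 2 < 1 := by nlinarith
  have hv1 : v < 1 := by linarith
  have hv : c - σ * (1 - c) = v := by linarith
  have hv0 : c - σ * (0 - c) = v + σ := by linarith
  have hH : ∀ x, c - σ * (x - c) = v + σ * (1 - x) := fun x => by linarith
  have hM : 0 < 1 - σ ^ 2 * (1 - v) - a := by
    have := mul_pos (sub_pos.2 hv1) (sub_pos.2 hσ3)
    linarith
  obtain ⟨Kl, l, hl, hl0, hla, hlb, hlM⟩ := exists_lipschitz_slope hav (div_pos hσ ha)
    (div_pos ha hσ) (sub_pos.2 hgap)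
  obtain ⟨Kr, r, hr, hr0, hra, hrb, hrM⟩ := exists_lipschitz_slope hgap (div_pos hσ2 ha)
    (div_pos ha hσ2) hM
  obtain ⟨φ, hφ, hφl, hφr, hφs, hφ0⟩ := exists_selfSimilar_slope (c := c) (σ := σ) (l := l)
    (r := fun x => -r x) (K := max Kl Kr) hc0 hc1 hσ hσ1 (hl.weaken (le_max_left _ _))
    (hr.neg.weaken (le_max_right _ _)) hl0 (fun x => neg_neg_of_pos (hr0 x))
    (by rw [hv, hlb v le_rfl, hrb 1 (by linarith)]; field_simp)
    (by rw [hv0, hra _ le_rfl, hla 0 ha.le]; field_simp)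
    (by linarith) (by linarith)
  rw [hv] at hφl
  rw [hv0] at hφr
  have hφc : φ c = 0 := by
    have := hφs c ⟨hc0.le, hc1.le⟩
    rw [sub_self, mul_zero, sub_zero] at this
    nlinarith
  obtain ⟨F, hF⟩ : ∃ F : ℝ → ℝ, ∀ x, F x = 1 + ∫ y in c..x, φ y := ⟨_, fun _ => rfl⟩
  have hFd : ∀ x, HasDerivAt F (φ x) x := fun x => by
    rw [show F = fun x => 1 + ∫ y in c..x, φ y from funext hF]
    exact (hφ.continuous.integral_hasStrictDerivAt c x).hasDerivAt.const_add 1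
  have hint : ∀ x y, IntervalIntegrable φ MeasureTheory.volume x y := fun x y =>
    hφ.continuous.intervalIntegrable x y
  have hsub : ∀ x y, ∫ z in x..y, φ z = F y - F x := fun x y =>
    intervalIntegral.integral_eq_sub_of_hasDerivAt (fun z _ => hFd z) (hint x y)
  have hFc : F c = 1 := by rw [hF, intervalIntegral.integral_same, add_zero]
  have hFs : ∀ x ∈ Icc (0 : ℝ) 1, F (v + σ * (1 - x)) = 1 - σ ^ 2 * (1 - F x) := by
    intro x hx
    have e1 : ∫ y in c..x, φ (c + σ * c - σ * y) = ∫ y in c..x, -σ * φ y := by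
      refine intervalIntegral.integral_congr fun y hy => ?_
      have hy' : y ∈ Icc (0 : ℝ) 1 := (convex_Icc (0 : ℝ) 1).ordConnected.uIcc_subset
        ⟨hc0.le, hc1.le⟩ hx hy
      rw [← hφs y hy']
      congr 1; ring
    rw [intervalIntegral.integral_comp_sub_mul φ hσ.ne', intervalIntegral.integral_const_mul,
      hsub, hsub, smul_eq_mul, hFc, show c + σ * c - σ * c = c by ring, hFc,
      show c + σ * c - σ * x = v + σ * (1 - x) by linarith] at e1
    field_simp at e1
    linarith
  have hl' : ∀ x y, 0 ≤ x → y ≤ v → x ≤ y → ∫ z in x..y, φ z = ∫ z in x..y, l z := by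
    intro x y hx hy hxy
    refine intervalIntegral.integral_congr fun z hz => ?_
    rw [uIcc_of_le hxy] at hz
    exact hφl z ⟨hx.trans hz.1, hz.2.trans hy⟩
  have hr' : ∀ x y, v + σ ≤ x → y ≤ 1 → x ≤ y → ∫ z in x..y, φ z = -∫ z in x..y, r z := by
    intro x y hx hy hxy
    rw [← intervalIntegral.integral_neg]
    refine intervalIntegral.integral_congr fun z hz => ?_
    rw [uIcc_of_le hxy] at hz
    exact hφr z ⟨hx.trans hz.1, hz.2.trans hy⟩
  have hleft : ∀ x ∈ Icc 0 a, F x = F 0 + σ * x / a := by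
    intro x hx
    have h1 := hl' 0 x le_rfl (by linarith [hx.2]) hx.1
    have h2 : ∫ z in (0 : ℝ)..x, l z = ∫ z in (0 : ℝ)..x, σ / a := by
      refine intervalIntegral.integral_congr fun z hz => ?_
      rw [uIcc_of_le hx.1] at hz
      exact hla z (hz.2.trans hx.2)
    rw [hsub, h2, intervalIntegral.integral_const, smul_eq_mul] at h1
    rw [show σ * x / a = (x - 0) * (σ / a) by ring]
    linarith
  have hright : ∀ x ∈ Icc (1 - σ ^ 2) 1, F x = F 1 + a * (1 - x) / σ ^ 2 := by
    intro x hx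
    have h1 := hr' x 1 (by linarith [hx.1]) le_rfl hx.2
    have h2 : ∫ z in x..1, r z = ∫ z in x..1, a / σ ^ 2 := by
      refine intervalIntegral.integral_congr fun z hz => ?_
      rw [uIcc_of_le hx.2] at hz
      exact hrb z (hx.1.trans hz.1)
    rw [hsub, h2, intervalIntegral.integral_const, smul_eq_mul] at h1
    rw [show a * (1 - x) / σ ^ 2 = (1 - x) * (a / σ ^ 2) by ring]
    linarith
  have e1 : F v - F a = 1 - σ ^ 2 - (v + σ) := by
    rw [← hsub, hl' a v ha.le le_rfl hav.le, hlM]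
  have e2 : F (1 - σ ^ 2) - F (v + σ) = -(1 - σ ^ 2 * (1 - v) - a) := by
    rw [← hsub, hr' _ _ le_rfl (by linarith) hgap.le, hrM]
  have e3 := hleft a ⟨ha.le, le_rfl⟩
  rw [mul_div_cancel_right₀ _ ha.ne'] at e3
  have e4 := hright (1 - σ ^ 2) ⟨le_rfl, by linarith⟩
  rw [sub_sub_cancel, mul_div_cancel_right₀ _ hσ2.ne'] at e4
  have e5 := hFs 1 (by simp)
  rw [sub_self, mul_zero, add_zero] at e5
  have e6 := hFs 0 (by simp)
  rw [sub_zero, mul_one] at e6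
  -- The end values were not imposed, only increments and `F c = 1`. The two branches and
  -- self-similarity give two linear relations whose only solution is `F 0 = v`, `F 1 = 0`, because
  -- `σ ^ 4 ≠ 1`.
  have h0 : F 0 - v = σ ^ 2 * F 1 := by linarith
  have h1 : F 1 = σ ^ 2 * (F 0 - v) := by linarith
  have hF1 : F 1 = 0 := by
    have : F 1 * (1 - (σ ^ 2) ^ 2) = 0 := by rw [h0] at h1; linarith
    rcases mul_eq_zero.1 this with h | h
    · exact h
    · nlinarith
  have hF0 : F 0 = v := by rw [hF1] at h0; linarith
  refine ⟨F, φ, ⟨⟨_, hφ⟩, hFd, hφ0, hφc, hFc, hF1, hFs, ?_, ?_⟩⟩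
  · rwa [hF0] at hleft
  · simpa [hF1] using hright

namespace IsSelfSimilar

variable {c v a σ : ℝ} {F g : ℝ → ℝ}

theorem strictMonoOn (H : IsSelfSimilar c v a σ F g) (hc1 : c < 1) : StrictMonoOn F (Icc 0 c) := by
  refine strictMonoOn_of_deriv_pos (convex_Icc 0 c)
    (fun x _ => (H.hasDerivAt x).continuousAt.continuousWithinAt) fun x hx => ?_
  rw [interior_Icc] at hx
  rw [(H.hasDerivAt x).deriv]
  exact pos_of_mul_pos_left (H.sign x ⟨hx.1.le, by linarith [hx.2]⟩ hx.2.ne)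
    (sub_nonneg.2 hx.2.le)

theorem strictAntiOn (H : IsSelfSimilar c v a σ F g) (hc0 : 0 < c) :
    StrictAntiOn F (Icc c 1) := by
  refine strictAntiOn_of_deriv_neg (convex_Icc c 1)
    (fun x _ => (H.hasDerivAt x).continuousAt.continuousWithinAt) fun x hx => ?_
  rw [interior_Icc] at hx
  rw [(H.hasDerivAt x).deriv]
  by_contra h
  have := H.sign x ⟨by linarith [hx.1], hx.2.le⟩ hx.1.ne'
  nlinarith [hx.1]

theorem map_zero (H : IsSelfSimilar c v a σ F g) (ha : 0 < a) : F 0 = v := by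
  simpa using H.left 0 ⟨le_rfl, ha.le⟩

theorem isC1LipUnimodal (H : IsSelfSimilar c v a σ F g) (hc0 : 0 < c) (hc1 : c < 1) (ha : 0 < a)
    (hv : 0 < v) : IsC1LipUnimodal F c := by
  have hm := H.strictMonoOn hc1
  have han := H.strictAntiOn hc0
  have hdw : EqOn (derivWithin F (Icc 0 1)) g (Icc 0 1) := fun x hx =>
    (H.hasDerivAt x).hasDerivWithinAt.derivWithin (uniqueDiffOn_Icc_zero_one x hx)
  obtain ⟨K, hK⟩ := H.lipschitz
  have hd : deriv F = g := funext fun x => (H.hasDerivAt x).deriv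
  refine ⟨⟨hc0, hc1⟩, ?_, ?_, ⟨K, ?_⟩, ?_, hm, han, H.map_crit, H.map_one⟩
  · intro x hx
    rcases le_total x c with h | h
    · have h1 := hm.monotoneOn ⟨le_rfl, hc0.le⟩ ⟨hx.1, h⟩ hx.1
      have h2 := hm.monotoneOn ⟨hx.1, h⟩ ⟨hc0.le, le_rfl⟩ h
      rw [H.map_zero ha] at h1
      rw [H.map_crit] at h2
      exact ⟨hv.le.trans h1, h2⟩
    · have h1 := han.antitoneOn ⟨h, hx.2⟩ ⟨hc1.le, le_rfl⟩ hx.2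
      have h2 := han.antitoneOn ⟨le_rfl, hc1.le⟩ ⟨h, hx.2⟩ h
      rw [H.map_one] at h1
      rw [H.map_crit] at h2
      exact ⟨h1, h2⟩
  · refine ContDiff.contDiffOn (contDiff_one_iff_deriv.2
      ⟨fun x => (H.hasDerivAt x).differentiableAt, ?_⟩)
    rw [hd]
    exact hK.continuous
  · intro x hx y hy
    rw [hdw hx, hdw hy]
    exact hK x y
  · intro x hx
    rw [hdw hx]
    constructor
    · intro h
      by_contra hxc
      have := H.sign x hx hxc
      rw [h, zero_mul] at this
      exact this.false
    · rintro rfl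
      exact H.deriv_crit

/-- The orbit of the centre is `[v, v + σ] → [1 - σ², 1] → [0, a] → [v, v + σ]`. The first step is
self-similarity and the other two are affine, so `F³ (h t) = h (F t)`. -/
theorem isFixedPoint (H : IsSelfSimilar c v a σ F g) (hc0 : 0 < c) (hc1 : c < 1) (ha : 0 < a)
    (hav : a < v) (hσ : 0 < σ) (hfix : v + σ * (1 - c) = c) (hgap : v + σ < 1 - σ ^ 2) :
    IsFixedPoint F c := by
  have hU := H.isC1LipUnimodal hc0 hc1 ha (ha.trans hav)
  have hσ2 : 0 < σ ^ 2 := by positivity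
  have f0 : F 0 = v := H.map_zero ha
  have fv : F v = 1 - σ ^ 2 := by
    have := H.selfSimilar 1 (by simp)
    rwa [H.map_one, sub_self, mul_zero, add_zero, sub_zero, mul_one] at this
  have fs : F (1 - σ ^ 2) = a := by
    rw [H.right _ ⟨le_rfl, by linarith⟩]
    field_simp
    ring
  have fa : F a = v + σ := by
    rw [H.left a ⟨ha.le, le_rfl⟩]
    field_simp
  have f4 : F^[4] 0 = v + σ := by
    simp only [Function.iterate_succ, Function.iterate_zero, Function.comp, id, f0, fv, fs, fa]
  have hJ : central F = Icc v (v + σ) := by rw [central, f0, f4]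
  have hpar : ∀ x ∈ Icc v (v + σ), ∃ t ∈ Icc (0 : ℝ) 1, x = v + σ * (1 - t) := by
    intro x hx
    refine ⟨1 - (x - v) / σ, ⟨?_, ?_⟩, by field_simp; ring⟩
    · rw [sub_nonneg, div_le_one hσ]; linarith [hx.2]
    · have : 0 ≤ (x - v) / σ := div_nonneg (by linarith [hx.1]) hσ.le
      linarith
  have g1 : ∀ t ∈ Icc (0 : ℝ) 1, F (v + σ * (1 - t)) ∈ Icc (1 - σ ^ 2) 1 := by
    intro t ht
    rw [H.selfSimilar t ht]
    have := hU.mapsTo ht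
    constructor <;> nlinarith [this.1, this.2]
  have g2 : ∀ t ∈ Icc (0 : ℝ) 1, F (F (v + σ * (1 - t))) = a * (1 - F t) := by
    intro t ht
    rw [H.right _ (g1 t ht), H.selfSimilar t ht]
    field_simp
    ring
  have g2' : ∀ t ∈ Icc (0 : ℝ) 1, F (F (v + σ * (1 - t))) ∈ Icc 0 a := by
    intro t ht
    rw [g2 t ht]
    have := hU.mapsTo ht
    constructor <;> nlinarith [this.1, this.2]
  have g3 : ∀ t ∈ Icc (0 : ℝ) 1, F^[3] (v + σ * (1 - t)) = v + σ * (1 - F t) := by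
    intro t ht
    simp only [Function.iterate_succ, Function.iterate_zero, Function.comp, id]
    rw [H.left _ (g2' t ht), g2 t ht]
    field_simp
  have i0 : F^[0] '' central F ⊆ Icc v (v + σ) := by
    rw [hJ, Function.iterate_zero, image_id]
  have i1 : F^[1] '' central F ⊆ Icc (1 - σ ^ 2) 1 := by
    rw [hJ]
    rintro _ ⟨x, hx, rfl⟩
    obtain ⟨t, ht, rfl⟩ := hpar x hx
    exact g1 t ht
  have i2 : F^[2] '' central F ⊆ Icc 0 a := by
    rw [hJ]
    rintro _ ⟨x, hx, rfl⟩
    obtain ⟨t, ht, rfl⟩ := hpar x hx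
    exact g2' t ht
  have dis : ∀ {A B : Set ℝ} {p q p' q' : ℝ}, A ⊆ Icc p q → B ⊆ Icc p' q' → q < p' →
      Disjoint (interior A) (interior B) := by
    intro A B p q p' q' hA hB h
    refine Disjoint.mono (interior_subset.trans hA) (interior_subset.trans hB) ?_
    exact Set.disjoint_left.2 fun x hx hx' => by linarith [hx.2, hx'.1]
  refine ⟨hU, ⟨?_, ?_, ?_, ?_⟩, ?_⟩
  · rw [f0, f4]
    constructor <;> nlinarith
  · rw [hJ]
    refine ⟨Icc_subset_Icc (by linarith) (by linarith), fun h => ?_⟩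
    have := (h (⟨le_rfl, zero_le_one⟩ : (0 : ℝ) ∈ Icc (0 : ℝ) 1)).1
    linarith
  · intro i hi j hj hij
    interval_cases i <;> interval_cases j <;> first
      | exact absurd rfl hij
      | exact dis i0 i1 hgap
      | exact (dis i0 i1 hgap).symm
      | exact dis i2 i0 hav
      | exact (dis i2 i0 hav).symm
      | exact dis i2 i1 (by linarith)
      | exact (dis i2 i1 (by linarith)).symm
  · rw [hJ]
    intro x hx
    obtain ⟨t, ht, rfl⟩ := hpar x hx
    rw [g3 t ht]
    have := hU.mapsTo ht
    constructor <;> nlinarith [this.1, this.2]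
  · intro t ht
    simp only [renorm, Function.comp, h, hInv]
    rw [f0, f4, add_sub_cancel_left, g3 t ht]
    field_simp
    ring

end IsSelfSimilar

/-! ### Scaling data at a feasible fixed point -/

theorem u_sub_mul {c : ℝ} (σ x : ℝ) :
    u c (c - σ * (x - c)) = 1 - σ ^ 2 * (1 - u c x) := by
  simp only [u]
  ring

theorem u_one {c : ℝ} (hc : c < 1) : u c 1 = 0 := by
  simp only [u]
  rw [div_self (sub_pos.2 hc).ne']
  norm_num

theorem isOpen_T (k : ℕ) : IsOpen (T k) := by
  have : T k = (⋂ i, {s : EuclideanSpace ℝ (Fin k) | 0 < s i}) ∩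
      {s : EuclideanSpace ℝ (Fin k) | ∑ i, s i < 1} := by
    ext s; simp [T]
  rw [this]
  refine (isOpen_iInter_of_finite fun i => isOpen_lt continuous_const ?_).inter
    (isOpen_lt ?_ continuous_const) <;> fun_prop

section FixedPoint

variable {c ε : ℝ}

/-- Relations between the scaling factors at a feasible fixed point of `𝓡(·, ε)`. -/
theorem relations_of_R_eq (hc : c ∈ feasible ε) (hR : R c ε = c) :
    u c 0 + s₂ c ε * (1 - c) = c ∧ s₃ c = s₂ c ε ^ 2 ∧ s₁ c ε < u c 0 ∧
      u c 0 + s₂ c ε < 1 - s₂ c ε ^ 2 := by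
  obtain ⟨hc0, hc1, h1, h2, h3, h4, h5⟩ := hc
  have e0 : u c (s₁ c ε) = u c 0 + s₂ c ε := by simp only [s₁, s₂]; ring
  have e1 : u c 0 + s₂ c ε * (1 - c) = c := by
    rw [R, div_eq_iff h2.ne'] at hR
    change u c (s₁ c ε) - c = _ at hR
    linarith
  -- Equivariance at `x = 1`: the point `1` is sent to `u c 0`, and `u c 1 = 0`.
  have e2 : (u c)^[2] 0 = 1 - s₂ c ε ^ 2 := by
    have := u_sub_mul (c := c) (s₂ c ε) 1
    rw [u_one (by linarith), show c - s₂ c ε * (1 - c) = u c 0 by linarith, sub_zero,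
      mul_one] at this
    exact this
  refine ⟨e1, by rw [s₃, e2]; ring, by linarith, by rw [← e0, ← e2]; linarith⟩

theorem scaling_zero (n : ℕ) : scaling c ε n 0 = s₁ c ε := by simp [scaling]

theorem scaling_one (n : ℕ) : scaling c ε n 1 = s₂ c ε := by simp [scaling]

theorem scaling_two (n : ℕ) : scaling c ε n 2 = s₃ c := by simp [scaling]

theorem branch_one_eq (hfix : u c 0 + s₂ c ε * (1 - c) = c) (n : ℕ) (x : ℝ) :
    branch c (scaling c ε n) 1 x = c - s₂ c ε * (x - c) := by
  simp only [branch, scaling_one]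
  linarith

theorem centralMap_eq (hfix : u c 0 + s₂ c ε * (1 - c) = c) (n : ℕ) (x : ℝ) :
    centralMap c (scaling c ε) n x = c + (-s₂ c ε) ^ n * (x - c) := by
  induction n generalizing x with
  | zero => simp [centralMap]
  | succ n ih =>
    rw [centralMap, Function.comp, branch_one_eq hfix, ih]
    ring

theorem mem_T_of_R_eq (hc : c ∈ feasible ε) (hR : R c ε = c) (n : ℕ) :
    scaling c ε n ∈ T 3 := by
  obtain ⟨-, e2, e3, e4⟩ := relations_of_R_eq hc hR
  obtain ⟨-, -, h1, h2, h3, -, -⟩ := hc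
  refine ⟨fun i => ?_, ?_⟩
  · fin_cases i
    · exact (scaling_zero (c := c) (ε := ε) n).symm ▸ h1
    · exact (scaling_one (c := c) (ε := ε) n).symm ▸ h2
    · exact (scaling_two (c := c) (ε := ε) n).symm ▸ h3
  · rw [Fin.sum_univ_three, scaling_zero, scaling_one, scaling_two]
    linarith

theorem isProper_of_R_eq (hc : c ∈ feasible ε) (hR : R c ε = c) :
    IsProper c (scaling c ε) := by
  have hT := mem_T_of_R_eq hc hR
  have hfix := (relations_of_R_eq hc hR).1
  obtain ⟨r, hr, hball⟩ := Metric.isOpen_iff.1 (isOpen_T 3) _ (hT 0)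
  -- The sum `m < 1` bounds every scaling factor, so an interval obtained from `n + 1` branches has
  -- length at most `m ^ (n + 1)`; `r` controls the distance to the frontier.
  obtain ⟨m, hm⟩ : ∃ m, m = ∑ i, scaling c ε 0 i := ⟨_, rfl⟩
  have hm1 : m < 1 := hm ▸ (hT 0).2
  have hle : ∀ i, scaling c ε 0 i ≤ m := fun i =>
    hm ▸ Finset.single_le_sum (f := fun i => scaling c ε 0 i) (fun j _ => ((hT 0).1 j).le)
      (Finset.mem_univ i)
  have hm0 : 0 < m := ((hT 0).1 0).trans_le (hle 0)
  have hσ0 : 0 < s₂ c ε := hc.2.2.2.1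
  have hσm : s₂ c ε ≤ m := scaling_one (c := c) (ε := ε) 0 ▸ hle 1
  have hδm : m ≤ 1 - min r (1 - m) := by linarith [min_le_right r (1 - m)]
  refine ⟨min r (1 - m), lt_min hr (by linarith), hT, fun n q hq => ?_, fun n j => ?_⟩
  · refine (min_le_left _ _).trans (not_lt.1 fun h => ?_)
    have hqT : q ∈ T 3 := hball (by rw [Metric.mem_ball, dist_comm]; exact h)
    rw [frontier, (isOpen_T 3).interior_eq] at hq
    exact hq.2 hqT
  · refine Metric.diam_le_of_forall_dist_le (by have := hm0.trans_le hδm; positivity) ?_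
    rintro _ ⟨x, hx, rfl⟩ _ ⟨y, hy, rfl⟩
    have hb : dist (branch c (scaling c ε n) j x) (branch c (scaling c ε n) j y) ≤ m := by
      have key : dist (branch c (scaling c ε n) j x) (branch c (scaling c ε n) j y) =
          scaling c ε n j * |x - y| := by
        have h0 := (hT n).1 j
        rw [Real.dist_eq, ← abs_of_pos h0, ← abs_mul]
        fin_cases j
        · rw [abs_sub_comm]; congr 1; simp only [branch, Fin.zero_eta]; ring
        · rw [abs_sub_comm]; congr 1; simp only [branch, Fin.mk_one]; ring
        · congr 1; simp only [branch, Fin.reduceFinMk]; ring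
      rw [key]
      have h1 : |x - y| ≤ 1 := abs_le.2 ⟨by linarith [hx.1, hy.2], by linarith [hx.2, hy.1]⟩
      exact (mul_le_of_le_one_right ((hT n).1 j).le h1).trans (hle j)
    rw [Function.comp, Function.comp, centralMap_eq hfix, centralMap_eq hfix, dist_add_left,
      Real.dist_eq, ← mul_sub, abs_mul, abs_pow, abs_neg, abs_of_pos hσ0, sub_sub_sub_cancel_right,
      ← Real.dist_eq, pow_succ]
    have := hm0.trans_le hδm
    gcongr
    · exact hσm.trans hδm
    · exact hb.trans hδm

theorem iInter_level_of_R_eq (hc : c ∈ feasible ε) (hR : R c ε = c) :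
    (⋂ n, level c (scaling c ε) 1 n) = {c} := by
  obtain ⟨hfix, e2, e3, e4⟩ := relations_of_R_eq hc hR
  obtain ⟨hc0, hc1, h1, hσ0, h3, -, -⟩ := hc
  have hσ1 : s₂ c ε < 1 := by nlinarith
  have hmap : ∀ n x, (centralMap c (scaling c ε) n ∘ branch c (scaling c ε n) 1) x =
      c + (-s₂ c ε) ^ (n + 1) * (x - c) := fun n x => centralMap_eq hfix (n + 1) x
  refine Subset.antisymm (fun x hx => ?_) (singleton_subset_iff.2 (mem_iInter.2 fun n => ?_))
  · rw [mem_singleton_iff]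
    by_contra hne
    obtain ⟨N, hN⟩ := exists_pow_lt_of_lt_one (abs_pos.2 (sub_ne_zero.2 hne)) hσ1
    obtain ⟨z, hz, hzx⟩ := mem_iInter.1 hx N
    rw [hmap] at hzx
    have hzc : |z - c| ≤ 1 := abs_le.2 ⟨by linarith [hz.1], by linarith [hz.2]⟩
    rw [← hzx, add_sub_cancel_left, abs_mul, abs_pow, abs_neg, abs_of_pos hσ0, pow_succ] at hN
    have hp := pow_pos hσ0 N
    have hle : s₂ c ε * |z - c| ≤ 1 := mul_le_one₀ hσ1.le (abs_nonneg _) hzc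
    nlinarith [mul_le_mul_of_nonneg_left hle hp.le]
  · exact ⟨c, ⟨hc0.le, by linarith⟩, by rw [hmap]; ring⟩

/-- `F` and `u c` obey the same law `1 - σ^(2n) (1 - ·)` under the `n`-th central map, so the
conditions at every level reduce to those on `[0, a]` and `[1 - σ², 1]`. -/
theorem exists_fixedPoint_of_R_eq (hc : c ∈ feasible ε) (hR : R c ε = c) :
    ∃ F, ExtendsPieces c (scaling c ε) F ∧ IsFixedPoint F c := by
  obtain ⟨hfix, e2, e3, e4⟩ := relations_of_R_eq hc hR
  obtain ⟨hc0, hc1, h1, hσ0, h3, -, -⟩ := hc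
  have hc1' : c < 1 := by linarith
  obtain ⟨F, g, H⟩ := exists_isSelfSimilar hc0 hc1' h1 e3 hσ0 hfix e4
  refine ⟨F, fun n t ht => ?_, H.isFixedPoint hc0 hc1' h1 e3 hσ0 hfix e4⟩
  have hσ1 : s₂ c ε < 1 := by nlinarith
  have hH : ∀ x, u c 0 + s₂ c ε * (1 - x) = c - s₂ c ε * (x - c) := fun x => by linarith
  have hF : ∀ n, ∀ x ∈ Icc (0 : ℝ) 1,
      F (centralMap c (scaling c ε) n x) = 1 - (s₂ c ε ^ 2) ^ n * (1 - F x) := by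
    intro n
    induction n with
    | zero => intro x _; simp [centralMap]
    | succ n ih =>
      intro x hx
      rw [centralMap, Function.comp, branch_one_eq hfix, ← hH, ih _ ?_, H.selfSimilar x hx]
      · ring
      · constructor <;> nlinarith [hx.1, hx.2]
  have hu : ∀ n x, u c (centralMap c (scaling c ε) n x) = 1 - (s₂ c ε ^ 2) ^ n * (1 - u c x) := by
    intro n
    induction n with
    | zero => intro x; simp [centralMap]
    | succ n ih =>
      intro x
      rw [centralMap, Function.comp, branch_one_eq hfix, ih, u_sub_mul]
      ring
  have e0 : u c (s₁ c ε) = u c 0 + s₂ c ε := by simp only [s₁, s₂]; ring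
  have hb0 : ∀ t, branch c (scaling c ε n) 0 t = s₁ c ε * (1 - t) := fun t => by
    simp only [branch, scaling_zero]
  have hb2 : ∀ t, branch c (scaling c ε n) 2 t = 1 - s₂ c ε ^ 2 * (1 - t) := fun t => by
    simp only [branch, scaling_two, e2]
  have hs1 : s₁ c ε < 1 := by nlinarith
  have hσ2 : 0 < s₂ c ε ^ 2 := by positivity
  have hσ3 : s₂ c ε ^ 2 < 1 := by nlinarith
  constructor
  · rw [hb0, hb0, hb0, hF n _ ?_, H.left _ ?_, hu, hu, sub_self, sub_zero, mul_zero, mul_one, e0]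
    · field_simp
      ring
    · constructor <;> nlinarith [ht.1, ht.2]
    · constructor <;> nlinarith [ht.1, ht.2]
  · rw [hb2, hF n _ ?_, H.right _ ?_, hu, u_one hc1', scaling_zero]
    · field_simp
      ring
    · constructor <;> nlinarith [ht.1, ht.2]
    · constructor <;> nlinarith [ht.1, ht.2]

end FixedPoint

/-! ### The parameter `q = c / (1 - c)` -/

/-- `-τ q` is the position of `u_c 0`, measured from `c` in units of `1 - c`. -/
def τ (q : ℝ) : ℝ := q ^ 2 + q ^ 3 - 1

/-- `(1 + q) u_c³ 0`. -/
def ω (q : ℝ) : ℝ := (1 + q) ^ 2 * τ q ^ 2 * (2 - (1 + q) * τ q ^ 2)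

/-- The fixed points of `𝓡(·, ε)` are the solutions of `ε η(q) = 1`. -/
def η (q : ℝ) : ℝ := (1 + q) ^ 2 * (q + √(1 - q ^ 3)) * (τ q * (2 - (1 + q) * τ q ^ 2))

section Coordinates

variable {q : ℝ}

/-- `X` is the position relative to `c = q / (1 + q)` in units of `1 - c = 1 / (1 + q)`. -/
theorem u_coord (hq : 0 < 1 + q) (X : ℝ) : u (q / (1 + q)) ((q + X) / (1 + q)) = 1 - X ^ 2 := by
  have h1 : 1 - q / (1 + q) = 1 / (1 + q) := by field_simp; ring
  have h2 : ((q + X) / (1 + q) - q / (1 + q)) / (1 / (1 + q)) = X := by field_simp; ring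
  rw [u, h1, h2]

theorem u_coord_zero (hq : 0 < 1 + q) : u (q / (1 + q)) 0 = 1 - q ^ 2 := by
  have := u_coord hq (-q)
  rwa [add_neg_cancel, zero_div, neg_sq] at this

theorem u_coord_iterate_two (hq : 0 < 1 + q) : (u (q / (1 + q)))^[2] 0 = 1 - τ q ^ 2 := by
  have h : (1 - q ^ 2 : ℝ) = (q + -τ q) / (1 + q) := by
    rw [eq_div_iff hq.ne']; simp only [τ]; ring
  simp only [Function.iterate_succ, Function.iterate_zero, Function.comp, id]
  rw [u_coord_zero hq, h, u_coord hq, neg_sq]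

theorem u_coord_iterate_three (hq : 0 < 1 + q) :
    (u (q / (1 + q)))^[3] 0 = ω q / (1 + q) := by
  have h : (1 - τ q ^ 2 : ℝ) = (q + (1 - (1 + q) * τ q ^ 2)) / (1 + q) := by
    rw [eq_div_iff hq.ne']; ring
  rw [Function.iterate_succ_apply', u_coord_iterate_two hq, h, u_coord hq, eq_div_iff hq.ne', ω]
  ring

theorem s₁_coord (hq : 0 < 1 + q) (ε : ℝ) : s₁ (q / (1 + q)) ε = ε * ω q / (1 + q) := by
  rw [s₁, u_coord_iterate_three hq, mul_div_assoc]

theorem u_s₁_coord (hq : 0 < 1 + q) (ε : ℝ) :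
    u (q / (1 + q)) (ε * (u (q / (1 + q)))^[3] 0) = 1 - (ε * ω q - q) ^ 2 := by
  rw [u_coord_iterate_three hq, ← u_coord hq (ε * ω q - q)]
  congr 1
  ring

theorem s₂_coord (hq : 0 < 1 + q) (ε : ℝ) :
    s₂ (q / (1 + q)) ε = q ^ 2 - (ε * ω q - q) ^ 2 := by
  rw [s₂, u_s₁_coord hq, u_coord_zero hq]
  ring

theorem s₃_coord (hq : 0 < 1 + q) : s₃ (q / (1 + q)) = τ q ^ 2 := by
  rw [s₃, u_coord_iterate_two hq]
  ring

/-- Isolating `c` turns the fixed point equation into the vanishing of a numerator, and makes the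
derivative at a fixed point easy to compute. -/
theorem R_coord (hq : 0 < 1 + q) {ε : ℝ} (h : q ^ 2 - (ε * ω q - q) ^ 2 ≠ 0) :
    R (q / (1 + q)) ε = q / (1 + q) +
      (1 - q ^ 3 - (ε * ω q - q) ^ 2) / ((1 + q) * (q ^ 2 - (ε * ω q - q) ^ 2)) := by
  rw [R, u_s₁_coord hq, s₂_coord hq]
  generalize ε * ω q - q = Y at *
  field_simp
  ring

theorem feasible_coord (hq : 0 < 1 + q) {ε : ℝ} :
    q / (1 + q) ∈ feasible ε ↔ 0 < q ∧ q < 1 ∧ 0 < ε * ω q ∧ 0 < q ^ 2 - (ε * ω q - q) ^ 2 ∧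
      0 < τ q ^ 2 ∧ 0 < -τ q - (ε * ω q - q) ∧ 0 < (ε * ω q - q) ^ 2 - τ q ^ 2 := by
  have e1 : u (q / (1 + q)) 0 - s₁ (q / (1 + q)) ε = (-τ q - (ε * ω q - q)) / (1 + q) := by
    rw [u_coord_zero hq, s₁_coord hq]
    generalize ε * ω q = Z
    simp only [τ]
    field_simp
    ring
  have e2 : (u (q / (1 + q)))^[2] 0 - u (q / (1 + q)) (s₁ (q / (1 + q)) ε) =
      (ε * ω q - q) ^ 2 - τ q ^ 2 := by
    rw [u_coord_iterate_two hq, s₁, u_s₁_coord hq]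
    ring
  have e3 : q / (1 + q) < 1 / 2 ↔ q < 1 := by
    rw [div_lt_div_iff₀ hq two_pos]
    constructor <;> intro h <;> linarith
  simp only [feasible, mem_ofPred_eq]
  rw [e1, e2, e3, s₁_coord hq, s₂_coord hq, s₃_coord hq, div_pos_iff_of_pos_right hq,
    div_pos_iff_of_pos_right hq, div_pos_iff_of_pos_right hq]

end Coordinates

/-! ### Monotonicity of `η` -/

section Monotone

theorem hasDerivAt_τ (q : ℝ) : HasDerivAt τ (2 * q + 3 * q ^ 2) q := by
  have h : HasDerivAt τ _ q := ((hasDerivAt_pow 2 q).add (hasDerivAt_pow 3 q)).sub_const 1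
  exact h.congr_deriv (by norm_num)

theorem sqrt_lower {q : ℝ} (hq0 : 0 ≤ q) (hq : q ≤ 9 / 10) : 13 / 25 < √(1 - q ^ 3) := by
  rw [Real.lt_sqrt (by norm_num)]
  have := pow_le_pow_left₀ hq0 hq 3
  norm_num at this ⊢
  linarith

theorem strictMonoOn_η_left :
    StrictMonoOn (fun q : ℝ => (1 + q) ^ 2 * (q + √(1 - q ^ 3))) (Icc (3 / 4) (9 / 10)) := by
  refine strictMonoOn_of_deriv_pos (convex_Icc _ _) (by fun_prop) fun q hq => ?_
  rw [interior_Icc] at hq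
  obtain ⟨h1, h2⟩ := hq
  have hy := sqrt_lower (by linarith) h2.le
  have hy0 : 0 < 1 - q ^ 3 := Real.sqrt_pos.1 (by linarith)
  have hy2 := Real.sq_sqrt hy0.le
  have hs : HasDerivAt (fun q : ℝ => √(1 - q ^ 3)) (-(3 * q ^ 2) / (2 * √(1 - q ^ 3))) q := by
    have := ((hasDerivAt_pow 3 q).const_sub 1).sqrt hy0.ne'
    simpa using this
  have hd := (((hasDerivAt_id q).const_add 1).pow 2).mul ((hasDerivAt_id q).add hs)
  have e : deriv (fun q : ℝ => (1 + q) ^ 2 * (q + √(1 - q ^ 3))) q = _ := hd.deriv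
  rw [e]
  simp only [id, Pi.add_apply, Pi.pow_apply]
  generalize √(1 - q ^ 3) = y at *
  -- This is the derivative times `2 * y / (1 + q)`, reduced by `y ^ 2 = 1 - q ^ 3`.
  have hpos : 0 < y * (6 * q + 2) + 4 - 3 * q ^ 2 - 7 * q ^ 3 := by
    have hA : 13 / 25 * (6 * q + 2) < y * (6 * q + 2) :=
      mul_lt_mul_of_pos_right hy (by linarith)
    have hB : q ^ 2 ≤ 81 / 100 := by nlinarith
    have hC : q ^ 3 ≤ 81 / 100 * q := by nlinarith
    nlinarith
  have : 0 < (1 + q) * (y * (6 * q + 2) + 4 - 3 * q ^ 2 - 7 * q ^ 3) / (2 * y) := by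
    apply div_pos (mul_pos (by linarith) hpos); linarith
  convert this using 1
  field_simp
  push_cast
  linear_combination (4 + 4 * q) * hy2

theorem strictMonoOn_η_right :
    StrictMonoOn (fun q : ℝ => τ q * (2 - (1 + q) * τ q ^ 2)) (Icc (3 / 4) (9 / 10)) := by
  refine strictMonoOn_of_deriv_pos (convex_Icc _ _) (by simp only [τ]; fun_prop) fun q hq => ?_
  rw [interior_Icc] at hq
  obtain ⟨h1, h2⟩ := hq
  have ht := hasDerivAt_τ q
  have hd := ht.mul ((((hasDerivAt_id q).const_add 1).mul (ht.pow 2)).const_sub 2)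
  have e : deriv (fun q : ℝ => τ q * (2 - (1 + q) * τ q ^ 2)) q = _ := hd.deriv
  rw [e]
  simp only [id, Pi.mul_apply, Pi.pow_apply]
  have hq2 : q ^ 2 ≤ (9 / 10) ^ 2 := pow_le_pow_left₀ (by linarith) h2.le 2
  have hq3 : q ^ 3 ≤ (9 / 10) ^ 3 := pow_le_pow_left₀ (by linarith) h2.le 3
  have hq2' : (3 / 4) ^ 2 ≤ q ^ 2 := pow_le_pow_left₀ (by linarith) h1.le 2
  have hq3' : (3 / 4) ^ 3 ≤ q ^ 3 := pow_le_pow_left₀ (by linarith) h1.le 3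
  have ht1 : τ q ≤ 539 / 1000 := by simp only [τ]; linarith
  have ht0 : -(1 / 50) ≤ τ q := by simp only [τ]; linarith
  generalize τ q = t at *
  have hd3 : 3 ≤ 2 * q + 3 * q ^ 2 := by linarith
  generalize 2 * q + 3 * q ^ 2 = d at *
  have ht2 : t ^ 2 ≤ 291 / 1000 := by nlinarith
  have ht3 : t ^ 3 ≤ 157 / 1000 := by nlinarith [sq_nonneg t]
  have h5 : (1 + q) * t ^ 2 ≤ 19 / 10 * (291 / 1000) := by gcongr; linarith
  have h6 : 1 / 4 ≤ 2 - 3 * ((1 + q) * t ^ 2) := by linarith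
  -- The derivative is `d * (2 - 3 * (1 + q) * t ^ 2) - t ^ 3`, and `t ^ 3` is well below `3 / 4`.
  have h7 : 3 * (1 / 4) ≤ d * (2 - 3 * ((1 + q) * t ^ 2)) :=
    mul_le_mul hd3 h6 (by norm_num) (by linarith)
  push_cast
  nlinarith

theorem strictMonoOn_η : StrictMonoOn η {q | q ∈ Icc (3 / 4) (9 / 10) ∧ 0 < τ q} := by
  rintro p ⟨hp, hp0⟩ q ⟨hq, -⟩ hpq
  have h1 := strictMonoOn_η_left hp hq hpq
  have h2 := strictMonoOn_η_right hp hq hpq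
  have hp2 : p ^ 2 ≤ (9 / 10) ^ 2 := pow_le_pow_left₀ (by linarith [hp.1]) hp.2 2
  have hp3 : p ^ 3 ≤ (9 / 10) ^ 3 := pow_le_pow_left₀ (by linarith [hp.1]) hp.2 3
  have ht1 : τ p ≤ 539 / 1000 := by simp only [τ]; linarith
  have h3 : 0 < τ p * (2 - (1 + p) * τ p ^ 2) := by
    refine mul_pos hp0 ?_
    have : (1 + p) * τ p ^ 2 ≤ (1 + 9 / 10) * (539 / 1000) ^ 2 := by
      gcongr
      exact hp.2
    norm_num at this
    linarith
  have h4 : 0 ≤ (1 + p) ^ 2 * (p + √(1 - p ^ 3)) :=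
    mul_nonneg (sq_nonneg _) (add_nonneg (by linarith [hp.1]) (Real.sqrt_nonneg _))
  exact mul_lt_mul' h1.le h2 h3.le (h4.trans_lt h1)

end Monotone

/-! ### Fixed points of `R`: location, existence, instability -/

section Fixed

variable {q ε : ℝ}

/-- A feasible fixed point solves `ε η(q) = 1`. -/
theorem eta_eq_of_R_eq (hq : 0 < 1 + q) (hc : q / (1 + q) ∈ feasible ε)
    (hR : R (q / (1 + q)) ε = q / (1 + q)) :
    (q ∈ Icc (3 / 4) (9 / 10) ∧ 0 < τ q) ∧ ε * η q = 1 := by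
  obtain ⟨hq0, hq1, h1, h2, h3, h4, h5⟩ := (feasible_coord hq).1 hc
  rw [R_coord hq h2.ne', add_eq_left, div_eq_zero_iff] at hR
  have hY : (ε * ω q - q) ^ 2 = 1 - q ^ 3 := by
    rcases hR with h | h
    · linarith
    · exact absurd h (mul_pos hq h2).ne'
  have ht : 0 < τ q := by rw [hY] at h2; simp only [τ]; linarith
  have hy0 : 0 ≤ 1 - q ^ 3 := hY ▸ sq_nonneg _
  -- The gap condition `0 < -τ q - (ε * ω q - q)` with `0 < τ q` selects this root.
  have hy : q - ε * ω q = √(1 - q ^ 3) := by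
    rw [← hY, ← neg_sub q, neg_sq, Real.sqrt_sq (by linarith)]
  refine ⟨⟨⟨?_, ?_⟩, ht⟩, ?_⟩
  · by_contra! h
    have a2 : q ^ 2 ≤ (3 / 4) ^ 2 := pow_le_pow_left₀ hq0.le h.le 2
    have a3 : q ^ 3 ≤ (3 / 4) ^ 3 := pow_le_pow_left₀ hq0.le h.le 3
    simp only [τ] at ht
    linarith
  -- The other gap condition reads `τ q ^ 2 < 1 - q ^ 3`, which fails from `9 / 10` on.
  · by_contra! h
    have a2 : (9 / 10) ^ 2 ≤ q ^ 2 := pow_le_pow_left₀ (by norm_num) h.le 2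
    have a3 : (9 / 10) ^ 3 ≤ q ^ 3 := pow_le_pow_left₀ (by norm_num) h.le 3
    have a4 : 539 / 1000 ≤ τ q := by simp only [τ]; linarith
    have a5 : (539 / 1000) ^ 2 ≤ τ q ^ 2 := pow_le_pow_left₀ (by norm_num) a4 2
    rw [hY] at h5
    linarith
  -- Multiplying `ε * ω q = q - √(1 - q ^ 3)` by the conjugate turns the right side into `τ q`; `ω`
  -- contains `τ q ^ 2`, so one factor cancels.
  · have hmul : τ q * (ε * η q) = τ q * 1 := by
      have hsq := Real.sq_sqrt hy0
      have e : ε * ((1 + q) ^ 2 * τ q ^ 2 * (2 - (1 + q) * τ q ^ 2)) = q - √(1 - q ^ 3) := by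
        rw [← hy, ω]; ring
      calc τ q * (ε * η q)
          = ε * ((1 + q) ^ 2 * τ q ^ 2 * (2 - (1 + q) * τ q ^ 2)) * (q + √(1 - q ^ 3)) := by
            rw [η]; ring
        _ = q ^ 2 - √(1 - q ^ 3) ^ 2 := by rw [e]; ring
        _ = τ q * 1 := by rw [hsq, τ]; ring
    exact mul_left_cancel₀ ht.ne' hmul

theorem bounds_of_mem (hq : q ∈ Ioo (39 / 50) (4 / 5)) :
    τ q ∈ Ioo (829 / 10000) (19 / 125) ∧ √(1 - q ^ 3) ∈ Ioo (698 / 1000) (725 / 1000) := by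
  obtain ⟨h1, h2⟩ := hq
  have a2 : q ^ 2 < (4 / 5) ^ 2 := pow_lt_pow_left₀ h2 (by linarith) two_ne_zero
  have a3 : q ^ 3 < (4 / 5) ^ 3 := pow_lt_pow_left₀ h2 (by linarith) three_ne_zero
  have b2 : (39 / 50) ^ 2 < q ^ 2 := pow_lt_pow_left₀ h1 (by norm_num) two_ne_zero
  have b3 : (39 / 50) ^ 3 < q ^ 3 := pow_lt_pow_left₀ h1 (by norm_num) three_ne_zero
  refine ⟨⟨?_, ?_⟩, ?_, ?_⟩
  · simp only [τ]; linarith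
  · simp only [τ]; linarith
  · rw [Real.lt_sqrt (by norm_num)]; linarith
  · rw [Real.sqrt_lt' (by norm_num)]; linarith

/-- Solutions of `ε η(q) = 1` near `q = 0.787` are feasible fixed points. -/
theorem fixed_of_eta_eq (hq : q ∈ Ioo (39 / 50) (4 / 5)) (h : ε * η q = 1) :
    ε * ω q - q = -√(1 - q ^ 3) ∧ q / (1 + q) ∈ feasible ε ∧
      R (q / (1 + q)) ε = q / (1 + q) := by
  obtain ⟨⟨t1, t2⟩, y1, y2⟩ := bounds_of_mem hq
  obtain ⟨h1, h2⟩ := hq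
  have hq0 : 0 < 1 + q := by linarith
  have hy0 : 0 < 1 - q ^ 3 := Real.sqrt_pos.1 (by linarith)
  have hsq := Real.sq_sqrt hy0.le
  have hτ : τ q = q ^ 2 - √(1 - q ^ 3) ^ 2 := by rw [hsq, τ]; ring
  have e : ε * ω q - q = -√(1 - q ^ 3) := by
    have hne : q + √(1 - q ^ 3) ≠ 0 := by linarith
    have : (q + √(1 - q ^ 3)) * (ε * ω q) = (q + √(1 - q ^ 3)) * (q - √(1 - q ^ 3)) := by
      calc (q + √(1 - q ^ 3)) * (ε * ω q) = τ q * (ε * η q) := by rw [η, ω]; ring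
        _ = (q + √(1 - q ^ 3)) * (q - √(1 - q ^ 3)) := by rw [h, hτ]; ring
    linarith [mul_left_cancel₀ hne this]
  have h2' : q ^ 2 - (ε * ω q - q) ^ 2 = τ q := by rw [e, neg_sq, ← hτ]
  refine ⟨e, (feasible_coord hq0).2 ⟨by linarith, by linarith, ?_, ?_, ?_, ?_, ?_⟩, ?_⟩
  · linarith
  · rw [h2']; linarith
  · have : 0 < τ q := by linarith
    positivity
  · rw [e]; linarith
  · rw [e, neg_sq]; nlinarith
  · rw [R_coord hq0 (by rw [h2']; linarith), e, neg_sq, hsq, sub_self, zero_div, add_zero]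

/-- Intermediate values: `η < 10 / 11` at `39 / 50` and `η > 10 / 9` at `4 / 5`, the reciprocals of
the extreme `ε`. -/
theorem exists_eta_eq (hε : ε ∈ Ioo (9 / 10) (11 / 10)) :
    ∃ q ∈ Ioo (39 / 50) (4 / 5), ε * η q = 1 := by
  have hcont : ContinuousOn (fun q => ε * η q) (Icc (39 / 50) (4 / 5)) := by
    simp only [η, τ]; fun_prop
  have y1 : √(1 - (39 / 50) ^ 3) < 726 / 1000 := by
    rw [Real.sqrt_lt' (by norm_num)]; norm_num
  have y2 : 698 / 1000 < √(1 - (4 / 5) ^ 3) := by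
    rw [Real.lt_sqrt (by norm_num)]; norm_num
  have h1 : ε * η (39 / 50) < 1 := by
    have hη : η (39 / 50) < 10 / 11 := by
      simp only [η, τ]
      norm_num at y1 ⊢
      linarith
    have h0 : 0 ≤ ε := by linarith [hε.1]
    nlinarith [hε.2]
  have h2 : 1 < ε * η (4 / 5) := by
    have hη : 10 / 9 < η (4 / 5) := by
      simp only [η, τ]
      norm_num at y2 ⊢
      linarith
    nlinarith [hε.1]
  exact intermediate_value_Ioo (by norm_num) hcont ⟨h1, h2⟩

theorem hasDerivAt_ω (q : ℝ) :
    HasDerivAt ω (2 * (1 + q) * τ q ^ 2 * (2 - (1 + q) * τ q ^ 2) + (1 + q) ^ 2 * τ q *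
      (2 * (2 * q + 3 * q ^ 2) * (2 - 2 * ((1 + q) * τ q ^ 2)) - τ q ^ 3)) q := by
  have ht := hasDerivAt_τ q
  have hl := (hasDerivAt_id q).const_add 1
  have hd : HasDerivAt ω _ q :=
    ((hl.pow 2).mul (ht.pow 2)).mul ((hl.mul (ht.pow 2)).const_sub 2)
  convert hd using 1
  simp only [id, Pi.mul_apply, Pi.pow_apply]
  push_cast
  ring

/-- The fixed point is unstable. -/
theorem one_lt_deriv_R (hε : ε ∈ Ioo (9 / 10) (11 / 10)) (hq : q ∈ Ioo (39 / 50) (4 / 5))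
    (h : ε * η q = 1) : 1 < |deriv (fun c => R c ε) (q / (1 + q))| := by
  obtain ⟨e, -, -⟩ := fixed_of_eta_eq hq h
  obtain ⟨⟨t1, t2⟩, y1, y2⟩ := bounds_of_mem hq
  obtain ⟨h1, h2⟩ := hq
  have hq0 : 0 < 1 + q := by linarith
  have hy0 : 0 < 1 - q ^ 3 := Real.sqrt_pos.1 (by linarith)
  have hsq := Real.sq_sqrt hy0.le
  have hden : q ^ 2 - (ε * ω q - q) ^ 2 = τ q := by rw [e, neg_sq, hsq, τ]; ring
  obtain ⟨w, hw⟩ : ∃ w, HasDerivAt ω w q ∧ 13 / 4 < w := by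
    refine ⟨_, hasDerivAt_ω q, ?_⟩
    have b2 : (39 / 50) ^ 2 < q ^ 2 := pow_lt_pow_left₀ h1 (by norm_num) two_ne_zero
    have hd3 : 33 / 10 ≤ 2 * q + 3 * q ^ 2 := by linarith
    generalize τ q = t at *
    generalize 2 * q + 3 * q ^ 2 = d at *
    have ht2 : t ^ 2 ≤ (19 / 125) ^ 2 := pow_le_pow_left₀ (by linarith) t2.le 2
    have ht3 : t ^ 3 ≤ (19 / 125) ^ 3 := pow_le_pow_left₀ (by linarith) t2.le 3
    have a1 : (1 + q) * t ^ 2 ≤ (1 + 4 / 5) * (19 / 125) ^ 2 := by gcongr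
    have a2 : 0 ≤ 2 * (1 + q) * t ^ 2 * (2 - (1 + q) * t ^ 2) := by
      refine mul_nonneg (by positivity) (by norm_num at a1; linarith)
    have a3 : 33 / 10 * (19 / 10) ≤ d * (2 - 2 * ((1 + q) * t ^ 2)) :=
      mul_le_mul hd3 (by norm_num at a1; linarith) (by norm_num) (by linarith)
    have a4 : 25 / 2 ≤ 2 * d * (2 - 2 * ((1 + q) * t ^ 2)) - t ^ 3 := by
      norm_num at ht3; linarith
    have a5 : (89 / 50) ^ 2 * (829 / 10000) * (25 / 2) ≤
        (1 + q) ^ 2 * t * (2 * d * (2 - 2 * ((1 + q) * t ^ 2)) - t ^ 3) := by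
      gcongr
      linarith
    norm_num at a5
    linarith
  obtain ⟨hω, hw⟩ := hw
  set c := q / (1 + q) with hc
  have hc1 : c < 1 := by rw [hc, div_lt_one hq0]; linarith
  have hqc : c / (1 - c) = q := by rw [hc]; field_simp; ring
  have hκ : HasDerivAt (fun x : ℝ => x / (1 - x)) (1 / (1 - c) ^ 2) c := by
    have h : HasDerivAt (fun x : ℝ => x / (1 - x)) _ c :=
      (hasDerivAt_id c).div ((hasDerivAt_id c).const_sub 1) (sub_pos.2 hc1).ne'
    refine h.congr_deriv ?_
    simp only [id]
    ring
  have hY : HasDerivAt (fun q => ε * ω q - q) (ε * w - 1) q :=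
    (hω.const_mul ε).sub (hasDerivAt_id q)
  have hnum : HasDerivAt (fun q => 1 - q ^ 3 - (ε * ω q - q) ^ 2)
      (2 * √(1 - q ^ 3) * (ε * w - 1) - 3 * q ^ 2) q := by
    refine (((hasDerivAt_pow 3 q).const_sub 1).sub (hY.pow 2)).congr_deriv ?_
    rw [e]
    push_cast
    ring
  have hpos : 0 < 2 * √(1 - q ^ 3) * (ε * w - 1) - 3 * q ^ 2 := by
    have a1 : 9 / 10 * (13 / 4) ≤ ε * w :=
      mul_le_mul hε.1.le hw.le (by norm_num) (by linarith [hε.1])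
    have a2 : q ^ 2 < (4 / 5) ^ 2 := pow_lt_pow_left₀ h2 (by linarith) two_ne_zero
    nlinarith
  have hDd : DifferentiableAt ℝ (fun q => (1 + q) * (q ^ 2 - (ε * ω q - q) ^ 2)) q := by
    have := hY.differentiableAt
    fun_prop
  have hD0 : 0 < (1 + q) * (q ^ 2 - (ε * ω q - q) ^ 2) := by
    rw [hden]; exact mul_pos hq0 (by linarith)
  obtain ⟨D', hD'⟩ : ∃ D', HasDerivAt (fun q => (1 + q) * (q ^ 2 - (ε * ω q - q) ^ 2)) D' q :=
    ⟨_, hDd.hasDerivAt⟩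
  have hquot := hnum.div hD' hD0.ne'
  -- The numerator vanishes at the fixed point, so `D'` drops out and the derivative of `R` is `1`
  -- plus a quantity with the sign of the numerator's derivative, positive by `hpos`.
  have hN0 : 1 - q ^ 3 - (ε * ω q - q) ^ 2 = 0 := by rw [e, neg_sq, hsq, sub_self]
  rw [hN0, zero_mul, sub_zero] at hquot
  have hR := (hasDerivAt_id c).add (hquot.comp_of_eq c hκ hqc.symm)
  have hev : (fun x => R x ε) =ᶠ[nhds c] (id + (fun q => (1 - q ^ 3 - (ε * ω q - q) ^ 2) /
      ((1 + q) * (q ^ 2 - (ε * ω q - q) ^ 2))) ∘ fun x : ℝ => x / (1 - x)) := by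
    have hcont : ContinuousAt (fun x : ℝ => x / (1 - x)) c := hκ.continuousAt
    have hDc : ContinuousAt (fun q => (1 + q) * (q ^ 2 - (ε * ω q - q) ^ 2)) (c / (1 - c)) := by
      rw [hqc]; exact hDd.continuousAt
    have hev1 := (hDc.comp (f := fun x : ℝ => x / (1 - x)) hcont).eventually_ne
      (by simp only [Function.comp, hqc]; exact hD0.ne')
    filter_upwards [hev1, eventually_lt_nhds hc1] with x hx hx1
    have hx0 : 0 < 1 - x := by linarith
    have hp : 1 + x / (1 - x) = 1 / (1 - x) := by field_simp; ring
    have hp0 : 0 < 1 + x / (1 - x) := by rw [hp]; positivity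
    have hxe : x / (1 - x) / (1 + x / (1 - x)) = x := by rw [hp]; field_simp
    have := R_coord hp0 (ε := ε) (right_ne_zero_of_mul hx)
    rw [hxe] at this
    exact this
  rw [(hR.congr_of_eventuallyEq hev).deriv, lt_abs]
  left
  have hq' : 0 < (1 - c) ^ 2 := pow_pos (sub_pos.2 hc1) 2
  rw [lt_add_iff_pos_right]
  positivity

end Fixed

end

/-! ### The one-parameter family and the cardinality -/

section Family

theorem IsC1LipUnimodal.lt_one {f : ℝ → ℝ} {c x : ℝ} (hf : IsC1LipUnimodal f c)
    (hx : x ∈ Icc (0 : ℝ) 1) (hxc : x ≠ c) : f x < 1 := by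
  rw [← hf.map_crit]
  rcases hxc.lt_or_gt with h | h
  · exact hf.mono ⟨hx.1, h.le⟩ ⟨hf.mem.1.le, le_rfl⟩ h
  · exact hf.anti ⟨le_rfl, hf.mem.2.le⟩ ⟨h.le, hx.2⟩ h

/-- The critical point is the only point of `[0, 1]` with value `1`, so the values on `[0, 1]`
determine it. -/
theorem IsC1LipUnimodal.crit_unique {f g : ℝ → ℝ} {c d : ℝ} (hf : IsC1LipUnimodal f c)
    (hg : IsC1LipUnimodal g d)
    (h : (Icc (0 : ℝ) 1).domRestrict f = (Icc (0 : ℝ) 1).domRestrict g) : c = d := by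
  by_contra hne
  have hc : c ∈ Icc (0 : ℝ) 1 := ⟨hf.mem.1.le, hf.mem.2.le⟩
  have h1 := hg.lt_one hc hne
  have h2 : f c = g c := congrFun h ⟨c, hc⟩
  rw [← h2, hf.map_crit] at h1
  exact h1.false

/-- A continuous function is determined on a countable dense set, and `𝔠 ^ ℵ₀ = 𝔠`. -/
theorem mk_continuousMap_le {X : Type} [TopologicalSpace X] [TopologicalSpace.SeparableSpace X] :
    Cardinal.mk C(X, ℝ) ≤ Cardinal.continuum := by
  obtain ⟨s, hs, hd⟩ := TopologicalSpace.exists_countable_dense X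
  have : Countable s := hs
  have hinj : Function.Injective fun (f : C(X, ℝ)) (x : s) => f x := fun f g h =>
    ContinuousMap.ext fun x => congrFun
      (Continuous.ext_on hd f.continuous g.continuous fun y hy => congrFun h ⟨y, hy⟩) x
  refine (Cardinal.mk_le_of_injective hinj).trans ?_
  rw [← Cardinal.power_def, Cardinal.mk_real]
  refine (Cardinal.power_le_power_left Cardinal.continuum_ne_zero Cardinal.mk_le_aleph0).trans ?_
  rw [Cardinal.continuum_power_aleph0]

theorem mk_fixedPoints_le : Cardinal.mk fixedPoints ≤ Cardinal.continuum := by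
  have hcont : ∀ g : fixedPoints, Continuous g.1 := by
    rintro ⟨_, f, c, hf, rfl⟩
    exact hf.1.contDiff.continuousOn.domRestrict
  refine (Cardinal.mk_le_of_injective (f := fun g : fixedPoints =>
    (⟨g.1, hcont g⟩ : C(Icc (0 : ℝ) 1, ℝ))) fun g g' h => Subtype.ext ?_).trans mk_continuousMap_le
  exact congrArg DFunLike.coe h

/-- The fixed points of `𝓡(·, ε)`, and the maps they give rise to, for `ε` close to `1`. -/
theorem exists_fixedPoint_family : ∃ (cstar : ℝ → ℝ) (F : ℝ → ℝ → ℝ),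
    (∀ ε ∈ Ioo (9 / 10 : ℝ) (11 / 10),
      cstar ε ∈ feasible ε ∧ R (cstar ε) ε = cstar ε ∧
      (∀ c ∈ feasible ε, R c ε = c → c = cstar ε) ∧
      1 < |deriv (fun c => R c ε) (cstar ε)| ∧
      ExtendsPieces (cstar ε) (scaling (cstar ε) ε) (F ε) ∧ IsFixedPoint (F ε) (cstar ε)) ∧
    StrictAntiOn cstar (Ioo (9 / 10) (11 / 10)) := by
  choose! q hq hη using fun ε (hε : ε ∈ Ioo (9 / 10 : ℝ) (11 / 10)) => exists_eta_eq hε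
  have hfix := fun ε hε => (fixed_of_eta_eq (hq ε hε) (hη ε hε)).2
  choose! F hF using fun ε (hε : ε ∈ Ioo (9 / 10 : ℝ) (11 / 10)) =>
    exists_fixedPoint_of_R_eq (hfix ε hε).1 (hfix ε hε).2
  have hq0 : ∀ ε ∈ Ioo (9 / 10 : ℝ) (11 / 10), 0 < 1 + q ε := fun ε hε => by
    linarith [(hq ε hε).1]
  have hmem := fun ε hε => (eta_eq_of_R_eq (hq0 ε hε) (hfix ε hε).1 (hfix ε hε).2).1
  refine ⟨fun ε => q ε / (1 + q ε), F, fun ε hε => ⟨(hfix ε hε).1, (hfix ε hε).2,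
    fun c hc hR => ?_, one_lt_deriv_R hε (hq ε hε) (hη ε hε), hF ε hε⟩, fun ε hε ε' hε' h => ?_⟩
  · have hc1 : 0 < 1 - c := by linarith [hc.2.1]
    have hp : 1 + c / (1 - c) = 1 / (1 - c) := by field_simp; ring
    have hp0 : 0 < 1 + c / (1 - c) := by rw [hp]; positivity
    have hce : c / (1 - c) / (1 + c / (1 - c)) = c := by rw [hp]; field_simp
    obtain ⟨h1, h2⟩ := eta_eq_of_R_eq (q := c / (1 - c)) (ε := ε) hp0
      (by rwa [hce]) (by rwa [hce])
    have hε0 : ε ≠ 0 := by linarith [hε.1]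
    have := strictMonoOn_η.injOn h1 (hmem ε hε)
      (mul_left_cancel₀ hε0 (h2.trans (hη ε hε).symm))
    change c = q ε / (1 + q ε)
    rw [← this, hce]
  · have hlt : q ε' < q ε := by
      rw [← strictMonoOn_η.lt_iff_lt (hmem ε' hε') (hmem ε hε)]
      have h0 : 0 < ε := by linarith [hε.1]
      have h0' : 0 < ε' := by linarith [hε'.1]
      rw [eq_div_of_mul_eq h0.ne' ((mul_comm _ _).trans (hη ε hε)),
        eq_div_of_mul_eq h0'.ne' ((mul_comm _ _).trans (hη ε' hε'))]
      exact one_div_lt_one_div_of_lt h0 h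
    change q ε' / (1 + q ε') < q ε / (1 + q ε)
    rw [div_lt_div_iff₀ (hq0 ε' hε') (hq0 ε hε)]
    linarith

end Family

end PeriodTripling

theorem mainTheorem4 :
    (∃ δ : ℝ, 0 < δ ∧ δ < 1 ∧ ∃ (cstar : ℝ → ℝ) (F : ℝ → ℝ → ℝ),
      (∀ ε ∈ Set.Ioo (1 - δ) (1 + δ),
        -- `cstar ε` is the only fixed point of `𝓡(·, ε)` in the feasible domain, and is unstable
        cstar ε ∈ feasible ε ∧
        R (cstar ε) ε = cstar ε ∧
        (∀ c ∈ feasible ε, R c ε = c → c = cstar ε) ∧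
        1 < |deriv (fun c => R c ε) (cstar ε)| ∧
        -- it gives proper scaling data whose central intervals shrink to `cstar ε`
        IsProper (cstar ε) (scaling (cstar ε) ε) ∧
        (⋂ n, level (cstar ε) (scaling (cstar ε) ε) 1 n) = {cstar ε} ∧
        -- and the piece-wise affine map extends to a `C^{1+Lip}` fixed point of renormalization
        ExtendsPieces (cstar ε) (scaling (cstar ε) ε) (F ε) ∧
        IsFixedPoint (F ε) (cstar ε)) ∧
      -- distinct parameters give distinct fixed points
      StrictAntiOn cstar (Set.Ioo (1 - δ) (1 + δ)) ∧
      Set.InjOn (fun ε => (Set.Icc (0 : ℝ) 1).domRestrict (F ε)) (Set.Ioo (1 - δ) (1 + δ))) ∧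
    Cardinal.mk fixedPoints = Cardinal.continuum := by
  obtain ⟨cstar, F, hF, hanti⟩ := exists_fixedPoint_family
  have hinj : Set.InjOn (fun ε => (Set.Icc (0 : ℝ) 1).domRestrict (F ε))
      (Set.Ioo (9 / 10) (11 / 10)) := fun ε hε ε' hε' h =>
    hanti.injOn hε hε' ((hF ε hε).2.2.2.2.2.1.crit_unique (hF ε' hε').2.2.2.2.2.1 h)
  refine ⟨⟨1 / 10, by norm_num, by norm_num, cstar, F, ?_⟩,
    mk_fixedPoints_le.antisymm ?_⟩
  · rw [show (1 - 1 / 10 : ℝ) = 9 / 10 by norm_num, show (1 + 1 / 10 : ℝ) = 11 / 10 by norm_num]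
    refine ⟨fun ε hε => ?_, hanti, hinj⟩
    obtain ⟨h1, h2, h3, h4, h5, h6⟩ := hF ε hε
    exact ⟨h1, h2, h3, h4, isProper_of_R_eq h1 h2, iInter_level_of_R_eq h1 h2, h5, h6⟩
  · rw [← Cardinal.mk_Ioo_real (show (9 / 10 : ℝ) < 11 / 10 by norm_num)]
    exact Cardinal.mk_le_of_injective (f := fun ε : Set.Ioo (9 / 10 : ℝ) (11 / 10) =>
      (⟨_, F ε, cstar ε, (hF ε ε.2).2.2.2.2.2, rfl⟩ : fixedPoints)) fun ε ε' h =>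
        Subtype.ext (hinj ε.2 ε'.2 (congrArg Subtype.val h))
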